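/- **Model.** An $m\times n$ board is the rectangle $\{1,\dots,m\}\times\{1,\dots,n\}\subset\mathbb Z^2$, some of whose points are blocked, the others being open; its size is $mn$. Fix a finite alphabet $\Sigma$ of labels and an affinity function $G:\Sigma\times\Sigma\to\{0,1\}$. A tile is a lattice point with a label in $\Sigma$. Two tiles with labels $a,b$ are bonded if their points are at $\ell^1$-distance $1$ and $G(a,b)=G(b,a)=1$. A polyomino is a nonempty finite set of tiles at distinct points whose graph of bonded pairs is connected. A configuration consists of a board and a finite set of pairwise non-overlapping polyominoes on open points of the board, such that bonded tiles belong to the same polyomino. A step in a direction $d\in\{N,E,S,W\}$ moves all polyominoes simultaneously by one unit in direction $d$, except the stuck ones: those that would run into a blocked point, then those that would run into one of these polyominoes, and so on. Polyominoes that leave the board (that is, have a tile outside the rectangle after the move) are removed, and then polyominoes containing the two tiles of a bonded pair are merged. If all polyominoes are stuck, the configuration is unchanged. A tilt in direction $d$ repeats steps in direction $d$ until the configuration no longer changes. Write $C\to_* C'$ if $C'$ is obtained from $C$ by a sequence of tilts. A configuration strongly represents a set $S\subset\mathbb Z^2$ if it consists of a single polyomino whose tiles occupy exactly a translate of $S$.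 A configuration $C$ is strongly universal for a set $U$ of shapes if for every $u\in U$ there is a configuration $D$ that strongly represents $u$ with $C\to_* D$. A drop shape is a finite subset of $\mathbb Z^2$ that is obtained from a single point by repeatedly adding a point $p\notin S$ to the current set $S$, where $p$ is adjacent to $S$ and, for at least one of the four directions $d$ (with unit vector $e_d$), none of the points $p+ke_d$, $k\ge 1$, lies in $S$ or is adjacent to $S$; that is, a tile coming in from infinity along this half-line attaches to $S$ exactly at $p$. **Theorem.** There are a finite alphabet $\Sigma$, an affinity function $G$ and a constant $K$ such that for all integers $h\ge w\ge 1$ there is a configuration $C$ with the following properties. Its board has size at most $K h^2 w$; $C$ is strongly universal for the set $U$ of all drop shapes $u\subseteq\{1,\dots,h\}\times\{1,\dots,w\}$; and for every $u\in U$, some sequence of at most $K h^2 w$ tilts turns $C$ into a configuration that strongly represents $u$ (so there are no excess tiles). -/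

import Mathlib

namespace TiltAssembly

/-- The four cardinal directions. -/
inductive Dir
  | N | E | S | W

/-- The unit vector of a direction (`x` grows to the east, `y` to the north). -/
def Dir.vec : Dir → ℤ × ℤ
  | .N => (0, 1)
  | .E => (1, 0)
  | .S => (0, -1)
  | .W => (-1, 0)

/-- Two points of the square lattice are adjacent: their `ℓ¹` distance is `1`. -/
def Adjacent (p q : ℤ × ℤ) : Prop :=
  |p.1 - q.1| + |p.2 - q.2| = 1

/-! ### Boards, tiles, polyominoes, configurations -/

/-- The rectangle `{1, …, m} × {1, …, n}`. -/
def box (m n : ℕ) : Set (ℤ × ℤ) :=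
  Set.Icc 1 (m : ℤ) ×ˢ Set.Icc 1 (n : ℤ)

/-- An `m × n` board: the rectangle `{1, …, m} × {1, …, n}`, some of whose points are blocked;
the other points of the rectangle are open. -/
structure Board where
  m : ℕ
  n : ℕ
  blocked : Set (ℤ × ℤ)
  blocked_subset : blocked ⊆ box m n

/-- The number of locations of the board, open or blocked. -/
def Board.size (B : Board) : ℕ := B.m * B.n

/-- The set of open locations. -/
def Board.openCells (B : Board) : Set (ℤ × ℤ) := box B.m B.n \ B.blocked

/-- A tile: a lattice point together with an attachment label. -/
structure Tile (L : Type) where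
  pos : ℤ × ℤ
  label : L

/-- Two tiles are bonded (for the affinity function `G`): they are adjacent, and their labels
attract each other. -/
def Bonded {L : Type} (G : L → L → Bool) (s t : Tile L) : Prop :=
  Adjacent s.pos t.pos ∧ G s.label t.label = true ∧ G t.label s.label = true

/-- A polyomino: a nonempty finite set of tiles at distinct locations, such that the graph of its
bonded pairs of tiles is connected. As bonded tiles are adjacent, the set of its locations is
connected as well. -/
structure IsPolyomino {L : Type} (G : L → L → Bool) (P : Set (Tile L)) : Prop where
  finite : P.Finite
  nonempty : P.Nonempty
  injOn : Set.InjOn Tile.pos P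
  connected : ∀ s ∈ P, ∀ t ∈ P,
    Relation.ReflTransGen (fun a b => a ∈ P ∧ b ∈ P ∧ Bonded G a b) s t

/-- A board together with a collection of sets of tiles. -/
structure Config (L : Type) where
  board : Board
  polys : Set (Set (Tile L))

/-- A legal configuration: finitely many polyominoes on open locations of the board, distinct ones
not overlapping, and every bonded pair of tiles belonging to one and the same polyomino. -/
structure Config.IsLegal {L : Type} (G : L → L → Bool) (C : Config L) : Prop where
  finite : C.polys.Finite
  isPolyomino : ∀ P ∈ C.polys, IsPolyomino G P
  on_open : ∀ P ∈ C.polys, ∀ t ∈ P, t.pos ∈ C.board.openCells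
  no_overlap : ∀ P ∈ C.polys, ∀ Q ∈ C.polys, ∀ s ∈ P, ∀ t ∈ Q, s.pos = t.pos → P = Q
  merged : ∀ P ∈ C.polys, ∀ Q ∈ C.polys, ∀ s ∈ P, ∀ t ∈ Q, Bonded G s t → P = Q

/-! ### Steps and tilts -/

/-- A tile moved by one unit in direction `d`. -/
def Tile.shift {L : Type} (d : Dir) (t : Tile L) : Tile L := ⟨t.pos + d.vec, t.label⟩

/-- The polyominoes that cannot move by one unit in direction `d`: those that would run into a
blocked location, then those that would run into one of these polyominoes, and so on. -/
inductive Config.Stuck {L : Type} (C : Config L) (d : Dir) : Set (Tile L) → Prop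
  | wall (P : Set (Tile L)) (t : Tile L) (hP : P ∈ C.polys) (ht : t ∈ P)
      (hb : t.pos + d.vec ∈ C.board.blocked) : Config.Stuck C d P
  | push (P Q : Set (Tile L)) (s t : Tile L) (hP : P ∈ C.polys) (hQ : Config.Stuck C d Q)
      (hs : s ∈ P) (ht : t ∈ Q) (hst : s.pos + d.vec = t.pos) : Config.Stuck C d P

/-- The polyominoes after a simultaneous move by one unit in direction `d` and before merging:
stuck ones stay, the others are translated, and those leaving the board are removed. -/
def Config.moved {L : Type} (C : Config L) (d : Dir) : Set (Set (Tile L)) :=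
  {P | P ∈ C.polys ∧ C.Stuck d P} ∪
    {R | ∃ P ∈ C.polys, ¬ C.Stuck d P ∧ R = Tile.shift d '' P ∧
      ∀ t ∈ R, t.pos ∈ box C.board.m C.board.n}

/-- Two members of the collection `F` that contain the two tiles of a bonded pair. -/
def Attached {L : Type} (G : L → L → Bool) (F : Set (Set (Tile L))) (P Q : Set (Tile L)) : Prop :=
  P ∈ F ∧ Q ∈ F ∧ ∃ s ∈ P, ∃ t ∈ Q, Bonded G s t

/-- The result of merging all attached members of `F`: the unions of the classes of the
equivalence relation on `F` generated by attachment. -/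
def mergeAll {L : Type} (G : L → L → Bool) (F : Set (Set (Tile L))) : Set (Set (Tile L)) :=
  {U | ∃ P ∈ F, U = ⋃₀ {Q | Q ∈ F ∧ Relation.ReflTransGen (Attached G F) P Q}}

open Classical in
/-- One step in direction `d`. If all polyominoes are stuck, nothing changes. -/
noncomputable def step {L : Type} (G : L → L → Bool) (d : Dir) (C : Config L) : Config L :=
  if ∀ P ∈ C.polys, C.Stuck d P then C else ⟨C.board, mergeAll G (C.moved d)⟩

/-- A tilt in direction `d` turns `C` into `C'`: iterating the step in direction `d` from `C`
reaches `C'`, and `C'` is `d`-terminal. -/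
def Tilt {L : Type} (G : L → L → Bool) (d : Dir) (C C' : Config L) : Prop :=
  (∃ k : ℕ, (step G d)^[k] C = C') ∧ step G d C' = C'

/-- The tilt sequence `ds`, executed from `C`, ends in `C'`. -/
def TiltSeq {L : Type} (G : L → L → Bool) : List Dir → Config L → Config L → Prop
  | [], C, C' => C = C'
  | d :: ds, C, C' => ∃ C₁, Tilt G d C C₁ ∧ TiltSeq G ds C₁ C'

/-- `C` can be reconfigured into `C'` by tilts (transitive closure of single tilts). -/
def Reconfigurable {L : Type} (G : L → L → Bool) : Config L → Config L → Prop :=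
  Relation.TransGen (fun C C' => ∃ d, Tilt G d C C')

/-! ### Shapes, representation and universality -/

/-- `C` consists of a single polyomino whose tiles occupy exactly a translate of `S`. -/
def StronglyRepresents {L : Type} (C : Config L) (S : Set (ℤ × ℤ)) : Prop :=
  ∃ P : Set (Tile L), C.polys = {P} ∧ ∃ v : ℤ × ℤ, Tile.pos '' P = (fun p => p + v) '' S

/-- `C` can be reconfigured into every member of `T`. -/
def UniversalFor {L : Type} (G : L → L → Bool) (C : Config L) (T : Set (Config L)) : Prop :=
  ∀ D ∈ T, Reconfigurable G C D

/-- `C` is strongly universal for the set `U` of shapes. -/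
def StronglyUniversal {L : Type} (G : L → L → Bool) (C : Config L)
    (U : Set (Set (ℤ × ℤ))) : Prop :=
  ∃ T : Set (Config L), (∀ u ∈ U, ∃ D ∈ T, StronglyRepresents D u) ∧ UniversalFor G C T

/-- A new tile arriving from infinity out of direction `d` along a straight line attaches to the
shape `S` at `p`: the point `p` is not in `S` and is adjacent to `S`, and no point visited before
`p` is in `S` or adjacent to `S`. -/
def CanDrop (S : Set (ℤ × ℤ)) (d : Dir) (p : ℤ × ℤ) : Prop :=
  (p ∉ S ∧ ∃ q ∈ S, Adjacent p q) ∧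
    ∀ k : ℕ, 0 < k → p + k • d.vec ∉ S ∧ ∀ q ∈ S, ¬ Adjacent (p + k • d.vec) q

/-- Drop shapes: the shapes obtained from a single seed point by dropping tiles one at a time
from the four cardinal directions. -/
inductive IsDropShape : Set (ℤ × ℤ) → Prop
  | seed (p : ℤ × ℤ) : IsDropShape {p}
  | drop (S : Set (ℤ × ℤ)) (d : Dir) (p : ℤ × ℤ) (hS : IsDropShape S) (hp : CanDrop S d p) :
      IsDropShape (insert p S)

/-- The drop shapes contained in `{1, …, h} × {1, …, w}`. -/
def dropShapes (h w : ℕ) : Set (Set (ℤ × ℤ)) :=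
  {u | IsDropShape u ∧ u ⊆ box h w}

end TiltAssembly

namespace TiltAssembly

/-! One self-attracting label suffices. With n = h, the board makes the fixed tilt word S, E, S, W,
N, E act as one clock cycle on three parts that never interfere. The growing shape travels once
around a room of corridors of width at least n and returns to its home corner, where N and E leave
it stuck. A reservoir of tiles with period 4 follows a zigzag that advances it by exactly one
period, so one new tile reaches the foot of a staircase. At home, alternating N and E moves only
this tile, one stair per pair of tilts.

The number r of stairs climbed encodes the decision for that tile. The next S drops it into the r-th
shaft, and diagonal walls convert the shaft number into a row or column of a lane. The tile enters
the room during the third, fourth, fifth or sixth tilt of the cycle, so it meets the shape from the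
north, east, south or west respectively. Tile and shape move at equal speed, so their gap is
constant until the shape hits a wall; then the tile approaches along the half-line of `CanDrop` and
attaches exactly at the prescribed point (`drop_tilt`). A last shaft leads off the board, so a tile
can also be thrown away (`reach_discard`).

On the formal side, polyominoes that are pairwise apart never push one another and never merge, so
each moves until it meets a wall (`stuck_conf_iff`, `tilt_famAt`). The only other events are one
merge (`tilt_drop`) and one departure (`tilt_exit`). A full tilt thus reduces to separate arithmetic
checks for shape, tile and store.

A drop shape is built by induction on its construction, each attachment restoring the home position
(`reach_insert`, `exists_atHome`). A point outside the current bounding box must come from the side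
it lies on, which `CanDrop.exists_dir` shows to be possible. With M = hw stored tiles plus a seed
there are always enough tiles, and the remainder is discarded. Each tile costs at most 10n + 8
tilts, whence O(h²w) tilts; the board has sides O(hw) and O(h). -/

/-- The affinity function of a single label that attracts itself. -/
def selfAff : Fin 1 → Fin 1 → Bool := fun _ _ => true

/-! ### Translations of cells and the separation relation. -/

/-- The cell reached from `c` by `t` unit moves in direction `d`. -/
def mv (d : Dir) (t : ℤ) (c : ℤ × ℤ) : ℤ × ℤ := (c.1 + t * d.vec.1, c.2 + t * d.vec.2)

theorem mv_zero (d : Dir) (c : ℤ × ℤ) : mv d 0 c = c := by simp [mv]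

theorem mv_mv (d : Dir) (s t : ℤ) (c : ℤ × ℤ) : mv d s (mv d t c) = mv d (t + s) c := by
  simp only [mv, Prod.mk.injEq]; constructor <;> ring

theorem add_vec (d : Dir) (c : ℤ × ℤ) : c + d.vec = mv d 1 c := by
  ext <;> simp [mv]

theorem mv_add (d : Dir) (t : ℤ) (c o : ℤ × ℤ) : mv d t (c + o) = mv d t c + o := by
  ext <;> simp [mv] <;> ring

theorem mv_add_left (d : Dir) (t : ℤ) (c o : ℤ × ℤ) : mv d t (o + c) = o + mv d t c := by
  rw [add_comm, mv_add, add_comm]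

theorem mv_image_zero (d : Dir) (A : Set (ℤ × ℤ)) : mv d 0 '' A = A := by
  have : mv d 0 = id := funext (mv_zero d)
  rw [this, Set.image_id]

theorem mv_image_mv (d : Dir) (s t : ℤ) (A : Set (ℤ × ℤ)) :
    mv d s '' (mv d t '' A) = mv d (t + s) '' A := by
  rw [Set.image_image]; simp only [mv_mv]

theorem adjacent_comm {p q : ℤ × ℤ} : Adjacent p q ↔ Adjacent q p := by
  simp only [Adjacent, abs_sub_comm]

theorem adjacent_add (p q o : ℤ × ℤ) : Adjacent (p + o) (q + o) ↔ Adjacent p q := by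
  simp [Adjacent]

theorem adjacent_mv (d : Dir) (c : ℤ × ℤ) : Adjacent c (mv d 1 c) := by
  cases d <;> simp [Adjacent, mv, Dir.vec]

/-- The cells are distinct and not adjacent. -/
def Apart (a b : ℤ × ℤ) : Prop := a ≠ b ∧ ¬ Adjacent a b

theorem Apart.symm {a b : ℤ × ℤ} (h : Apart a b) : Apart b a :=
  ⟨h.1.symm, fun h' => h.2 (adjacent_comm.1 h')⟩

theorem Apart.of_far {a b : ℤ × ℤ}
    (h : a.1 + 2 ≤ b.1 ∨ b.1 + 2 ≤ a.1 ∨ a.2 + 2 ≤ b.2 ∨ b.2 + 2 ≤ a.2) : Apart a b := by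
  constructor
  · rintro rfl; omega
  · intro h'
    rw [Adjacent] at h'
    rcases abs_cases (a.1 - b.1) with h1 | h1 <;> rcases abs_cases (a.2 - b.2) with h2 | h2 <;>
      omega

theorem apart_mv (d : Dir) (t : ℤ) (a b : ℤ × ℤ) : Apart (mv d t a) (mv d t b) ↔ Apart a b := by
  have e : ∀ c, mv d t c = c + (t * d.vec.1, t * d.vec.2) := fun c => rfl
  rw [Apart, Apart, e, e, adjacent_add, ne_eq, add_left_inj]

/-! ### Configurations given by sets of cells -/

/-- The tile on the cell `c` of a coordinate system with origin `o`. -/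
def cellTile (o c : ℤ × ℤ) : Tile (Fin 1) := ⟨c + o, 0⟩

/-- The configuration on `B` whose polyominoes occupy the members of `F`, in coordinates with
origin `o`. -/
def conf (B : Board) (o : ℤ × ℤ) (F : Set (Set (ℤ × ℤ))) : Config (Fin 1) :=
  ⟨B, (fun A => cellTile o '' A) '' F⟩

/-- The cell is blocked. -/
def Blk (B : Board) (o c : ℤ × ℤ) : Prop := c + o ∈ B.blocked

/-- The cell lies on the board. -/
def Inb (B : Board) (o c : ℤ × ℤ) : Prop := c + o ∈ box B.m B.n

/-- Distinct members are apart. -/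
def Separated (F : Set (Set (ℤ × ℤ))) : Prop :=
  ∀ A ∈ F, ∀ A' ∈ F, A ≠ A' → ∀ a ∈ A, ∀ b ∈ A', Apart a b

/-- Some cell of `A` is next to a blocked cell in direction `d`. -/
def Walled (B : Board) (o : ℤ × ℤ) (d : Dir) (A : Set (ℤ × ℤ)) : Prop :=
  ∃ c ∈ A, Blk B o (mv d 1 c)

theorem cellTile_injective (o : ℤ × ℤ) : Function.Injective (cellTile o) := by
  intro a b h
  simpa [cellTile] using h

theorem image_cellTile_injective (o : ℤ × ℤ) :
    Function.Injective (fun A : Set (ℤ × ℤ) => cellTile o '' A) :=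
  (cellTile_injective o).image_injective

theorem shift_cellTile (d : Dir) (o : ℤ × ℤ) (A : Set (ℤ × ℤ)) :
    Tile.shift d '' (cellTile o '' A) = cellTile o '' (mv d 1 '' A) := by
  rw [Set.image_image, Set.image_image]
  refine Set.image_congr fun c _ => ?_
  simp only [Tile.shift, cellTile, add_vec, mv_add]

theorem bonded_cellTile (o a b : ℤ × ℤ) :
    Bonded selfAff (cellTile o a) (cellTile o b) ↔ Adjacent a b := by
  simp [Bonded, cellTile, selfAff, adjacent_add]

variable {B : Board} {o : ℤ × ℤ} {d : Dir}

/-- Being pushed requires an adjacent cell of another piece, which separation excludes; hence the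
inductive closure in `Config.Stuck` collapses to its wall case. -/
theorem stuck_conf_iff {F : Set (Set (ℤ × ℤ))} (hF : Separated F) {A : Set (ℤ × ℤ)} (hA : A ∈ F) :
    (conf B o F).Stuck d (cellTile o '' A) ↔ Walled B o d A := by
  constructor
  · intro h
    have key : ∀ P, (conf B o F).Stuck d P → ∃ A ∈ F, P = cellTile o '' A ∧ Walled B o d A := by
      intro P hP
      induction hP with
      | wall P t hP ht hb =>
        obtain ⟨A, hA, rfl⟩ := hP
        obtain ⟨c, hc, rfl⟩ := ht
        refine ⟨A, hA, rfl, c, hc, ?_⟩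
        simpa [cellTile, add_vec, mv_add, Blk, conf] using hb
      | push P Q s t hP hQ hs ht hst ih =>
        obtain ⟨A', hA', rfl, hw⟩ := ih
        obtain ⟨A, hA, rfl⟩ := hP
        obtain ⟨a, ha, rfl⟩ := hs
        obtain ⟨b, hb, rfl⟩ := ht
        by_cases hAA : A = A'
        · subst hAA; exact ⟨A, hA, rfl, hw⟩
        · exfalso
          refine (hF A hA A' hA' hAA a ha b hb).2 ?_
          have : mv d 1 a = b := by
            simpa [cellTile, add_vec, mv_add] using hst
          rw [← this]; exact adjacent_mv d a
    obtain ⟨A', _, h1, h2⟩ := key _ h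
    rwa [image_cellTile_injective o h1]
  · rintro ⟨c, hc, hb⟩
    refine Config.Stuck.wall _ (cellTile o c) ⟨A, hA, rfl⟩ ⟨c, hc, rfl⟩ ?_
    simpa [cellTile, add_vec, mv_add, Blk, conf] using hb

/-- The sets of cells after a simultaneous move. -/
def moveAll (B : Board) (o : ℤ × ℤ) (d : Dir) (F : Set (Set (ℤ × ℤ))) : Set (Set (ℤ × ℤ)) :=
  {A | A ∈ F ∧ Walled B o d A} ∪
    {A' | ∃ A ∈ F, ¬ Walled B o d A ∧ A' = mv d 1 '' A ∧ ∀ c ∈ A', Inb B o c}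

theorem moved_conf {F : Set (Set (ℤ × ℤ))} (hF : Separated F) :
    (conf B o F).moved d = (fun A => cellTile o '' A) '' moveAll B o d F := by
  ext P
  constructor
  · rintro (⟨⟨A, hA, rfl⟩, hs⟩ | ⟨Q, ⟨A, hA, rfl⟩, hs, rfl, hb⟩)
    · exact ⟨A, Or.inl ⟨hA, (stuck_conf_iff hF hA).1 hs⟩, rfl⟩
    · refine ⟨mv d 1 '' A, Or.inr ⟨A, hA, fun h => hs ((stuck_conf_iff hF hA).2 h), rfl, ?_⟩,
        (shift_cellTile d o A).symm⟩
      intro c hc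
      exact hb (cellTile o c) (by rw [shift_cellTile]; exact ⟨c, hc, rfl⟩)
  · rintro ⟨A, (⟨hA, hw⟩ | ⟨A, hA, hw, rfl, hb⟩), rfl⟩
    · exact Or.inl ⟨⟨A, hA, rfl⟩, (stuck_conf_iff hF hA).2 hw⟩
    · refine Or.inr ⟨cellTile o '' A, ⟨A, hA, rfl⟩, fun h => hw ((stuck_conf_iff hF hA).1 h),
        (shift_cellTile d o A).symm, ?_⟩
      rintro _ ⟨c, hc, rfl⟩
      exact hb c hc

theorem mergeAll_of_separated {F : Set (Set (ℤ × ℤ))} (hF : Separated F) :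
    mergeAll selfAff ((fun A => cellTile o '' A) '' F) = (fun A => cellTile o '' A) '' F := by
  set F' := (fun A => cellTile o '' A) '' F with hF'
  have att : ∀ P Q, Attached selfAff F' P Q → P = Q := by
    rintro _ _ ⟨⟨A, hA, rfl⟩, ⟨A', hA', rfl⟩, _, ⟨a, ha, rfl⟩, _, ⟨b, hb, rfl⟩, hab⟩
    by_contra hne
    exact (hF A hA A' hA' (fun h => hne (by rw [h])) a ha b hb).2 ((bonded_cellTile o a b).1 hab)
  have rtg : ∀ P Q, Relation.ReflTransGen (Attached selfAff F') P Q → P = Q := by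
    intro P Q h
    induction h with
    | refl => rfl
    | tail _ h ih => exact ih.trans (att _ _ h)
  have cls : ∀ P ∈ F', ⋃₀ {Q | Q ∈ F' ∧ Relation.ReflTransGen (Attached selfAff F') P Q} = P := by
    intro P hP
    have : {Q | Q ∈ F' ∧ Relation.ReflTransGen (Attached selfAff F') P Q} = {P} := by
      ext Q
      constructor
      · rintro ⟨_, h⟩; exact (rtg _ _ h).symm
      · rintro rfl; exact ⟨hP, .refl⟩
    rw [this, Set.sUnion_singleton]
  ext U
  constructor
  · rintro ⟨P, hP, rfl⟩; rw [cls P hP]; exact hP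
  · intro hU; exact ⟨U, hU, (cls U hU).symm⟩

/-- This is the only kind of merge that occurs: the attachment classes are the pair of shape and
arriving tile, and singletons for the stored tiles. -/
theorem mergeAll_insert_insert {R : Set (Set (ℤ × ℤ))} {P Q : Set (ℤ × ℤ)} (hR : Separated R)
    (hP : ∀ A ∈ R, ∀ a ∈ A, ∀ b ∈ P ∪ Q, Apart a b) (hPQ : ∃ a ∈ P, ∃ b ∈ Q, Adjacent a b) :
    mergeAll selfAff ((fun A => cellTile o '' A) '' insert P (insert Q R)) =
      (fun A => cellTile o '' A) '' insert (P ∪ Q) R := by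
  set F' := (fun A => cellTile o '' A) '' insert P (insert Q R) with hF'
  have hPm : cellTile o '' P ∈ F' := ⟨P, by simp, rfl⟩
  have hQm : cellTile o '' Q ∈ F' := ⟨Q, by simp, rfl⟩
  have hRm : ∀ A ∈ R, cellTile o '' A ∈ F' := fun A hA => ⟨A, by simp [hA], rfl⟩
  have attR : ∀ A ∈ R, ∀ Y, Attached selfAff F' (cellTile o '' A) Y → Y = cellTile o '' A := by
    rintro A hA _ ⟨_, ⟨A', hA', rfl⟩, _, ⟨a, ha, rfl⟩, _, ⟨b, hb, rfl⟩, hab⟩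
    have hab' := (bonded_cellTile o a b).1 hab
    rcases hA' with rfl | rfl | hA'
    · exact absurd hab' (hP A hA a ha b (Or.inl hb)).2
    · exact absurd hab' (hP A hA a ha b (Or.inr hb)).2
    · by_contra hne
      exact (hR A hA A' hA' (fun h => hne (by rw [h])) a ha b hb).2 hab'
  have attP : ∀ X Y, (X = cellTile o '' P ∨ X = cellTile o '' Q) → Attached selfAff F' X Y →
      (Y = cellTile o '' P ∨ Y = cellTile o '' Q) := by
    rintro X _ hX ⟨_, ⟨A', hA', rfl⟩, s, hs, _, ⟨b, hb, rfl⟩, hab⟩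
    rcases hA' with rfl | rfl | hA'
    · exact Or.inl rfl
    · exact Or.inr rfl
    · exfalso
      have : ∃ a ∈ P ∪ Q, s = cellTile o a := by
        rcases hX with rfl | rfl
        · obtain ⟨a, ha, rfl⟩ := hs; exact ⟨a, Or.inl ha, rfl⟩
        · obtain ⟨a, ha, rfl⟩ := hs; exact ⟨a, Or.inr ha, rfl⟩
      obtain ⟨a, ha, rfl⟩ := this
      exact (hP A' hA' b hb a ha).2 (adjacent_comm.1 ((bonded_cellTile o a b).1 hab))
  have aPQ : Attached selfAff F' (cellTile o '' P) (cellTile o '' Q) := by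
    obtain ⟨a, ha, b, hb, hab⟩ := hPQ
    exact ⟨hPm, hQm, _, ⟨a, ha, rfl⟩, _, ⟨b, hb, rfl⟩, (bonded_cellTile o a b).2 hab⟩
  have aQP : Attached selfAff F' (cellTile o '' Q) (cellTile o '' P) := by
    obtain ⟨a, ha, b, hb, hab⟩ := hPQ
    exact ⟨hQm, hPm, _, ⟨b, hb, rfl⟩, _, ⟨a, ha, rfl⟩,
      (bonded_cellTile o b a).2 (adjacent_comm.1 hab)⟩
  have clsPQ : ∀ X, (X = cellTile o '' P ∨ X = cellTile o '' Q) →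
      ⋃₀ {Y | Y ∈ F' ∧ Relation.ReflTransGen (Attached selfAff F') X Y} =
        cellTile o '' (P ∪ Q) := by
    intro X hX
    have : {Y | Y ∈ F' ∧ Relation.ReflTransGen (Attached selfAff F') X Y} =
        {cellTile o '' P, cellTile o '' Q} := by
      ext Y
      constructor
      · rintro ⟨_, h⟩
        induction h with
        | refl => exact hX
        | tail _ h ih => exact attP _ _ (ih h.1) h
      · rintro (rfl | rfl)
        · refine ⟨hPm, ?_⟩
          rcases hX with rfl | rfl
          · exact .refl
          · exact .single aQP
        · refine ⟨hQm, ?_⟩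
          rcases hX with rfl | rfl
          · exact .single aPQ
          · exact .refl
    rw [this, Set.sUnion_pair, Set.image_union]
  have clsR : ∀ A ∈ R, ⋃₀ {Y | Y ∈ F' ∧
      Relation.ReflTransGen (Attached selfAff F') (cellTile o '' A) Y} = cellTile o '' A := by
    intro A hA
    have : {Y | Y ∈ F' ∧ Relation.ReflTransGen (Attached selfAff F') (cellTile o '' A) Y} =
        {cellTile o '' A} := by
      ext Y
      constructor
      · rintro ⟨_, h⟩
        induction h with
        | refl => rfl
        | tail _ h ih =>
          have ih' := ih h.1
          rw [Set.mem_singleton_iff] at ih'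
          subst ih'
          exact attR A hA _ h
      · rintro rfl; exact ⟨hRm A hA, .refl⟩
    rw [this, Set.sUnion_singleton]
  ext U
  constructor
  · rintro ⟨_, ⟨A, hA, rfl⟩, rfl⟩
    rcases hA with rfl | rfl | hA
    · exact ⟨_, Or.inl rfl, (clsPQ _ (Or.inl rfl)).symm⟩
    · exact ⟨_, Or.inl rfl, (clsPQ _ (Or.inr rfl)).symm⟩
    · exact ⟨A, Or.inr hA, (clsR A hA).symm⟩
  · rintro ⟨A, (rfl | hA), rfl⟩
    · exact ⟨_, hPm, (clsPQ _ (Or.inl rfl)).symm⟩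
    · exact ⟨_, hRm A hA, (clsR A hA).symm⟩

theorem step_conf_of_walled {F : Set (Set (ℤ × ℤ))} (hF : Separated F)
    (h : ∀ A ∈ F, Walled B o d A) : step selfAff d (conf B o F) = conf B o F := by
  rw [step, if_pos]
  rintro _ ⟨A, hA, rfl⟩
  exact (stuck_conf_iff hF hA).2 (h A hA)

/-- The clause for a wholly stuck configuration needs no separate treatment: moving and merging then
give back the same separated family. -/
theorem step_conf {F : Set (Set (ℤ × ℤ))} (hF : Separated F) :
    step selfAff d (conf B o F) =
      ⟨B, mergeAll selfAff ((fun A => cellTile o '' A) '' moveAll B o d F)⟩ := by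
  by_cases h : ∀ A ∈ F, Walled B o d A
  · rw [step_conf_of_walled hF h]
    have : moveAll B o d F = F := by
      ext A
      constructor
      · rintro (⟨hA, _⟩ | ⟨A, hA, hw, _⟩)
        · exact hA
        · exact absurd (h A hA) hw
      · intro hA; exact Or.inl ⟨hA, h A hA⟩
    rw [this, mergeAll_of_separated hF, conf]
  · rw [step, if_neg, moved_conf hF]
    · rfl
    · intro h'
      exact h fun A hA => (stuck_conf_iff hF hA).1 (h' _ ⟨A, hA, rfl⟩)

/-! ### Indexed families of pieces -/

/-- Pieces with distinct indices are apart. -/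
def FamApart (I : Set ℕ) (A : ℕ → Set (ℤ × ℤ)) : Prop :=
  ∀ i ∈ I, ∀ j ∈ I, i ≠ j → ∀ a ∈ A i, ∀ b ∈ A j, Apart a b

theorem FamApart.separated {I : Set ℕ} {A : ℕ → Set (ℤ × ℤ)} (h : FamApart I A) :
    Separated (A '' I) := by
  rintro _ ⟨i, hi, rfl⟩ _ ⟨j, hj, rfl⟩ hne
  exact h i hi j hj (fun e => hne (by rw [e]))

/-- The piece can be moved by `k` units in direction `d`. -/
def Free (B : Board) (o : ℤ × ℤ) (d : Dir) (A : Set (ℤ × ℤ)) (k : ℕ) : Prop :=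
  ∀ t : ℕ, t < k → ∀ c ∈ A, Inb B o (mv d (t + 1) c) ∧ ¬ Blk B o (mv d (t + 1) c)

/-- The piece can be moved by exactly `k` units in direction `d` before it meets a wall. -/
def Run (B : Board) (o : ℤ × ℤ) (d : Dir) (A : Set (ℤ × ℤ)) (k : ℕ) : Prop :=
  Free B o d A k ∧ ∃ c ∈ A, Blk B o (mv d (k + 1) c)

/-- The pieces at time `t`, when the `i`-th one moves for `k i` units of time. -/
def famAt (d : Dir) (A : ℕ → Set (ℤ × ℤ)) (k : ℕ → ℕ) (t : ℕ) (i : ℕ) : Set (ℤ × ℤ) :=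
  mv d ((min t (k i) : ℕ) : ℤ) '' A i

theorem famAt_zero (A : ℕ → Set (ℤ × ℤ)) (k : ℕ → ℕ) : famAt d A k 0 = A := by
  funext i
  simp [famAt, mv_image_zero]

theorem walled_famAt {A : ℕ → Set (ℤ × ℤ)} {k : ℕ → ℕ} {t i : ℕ} (h : k i ≤ t)
    (hw : ∃ c ∈ A i, Blk B o (mv d (k i + 1) c)) : Walled B o d (famAt d A k t i) := by
  obtain ⟨c, hc, hb⟩ := hw
  refine ⟨_, ⟨c, hc, rfl⟩, ?_⟩
  rw [mv_mv, min_eq_right h]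
  exact hb

theorem mv_famAt {A : ℕ → Set (ℤ × ℤ)} {k : ℕ → ℕ} {t i : ℕ} (h : t < k i) :
    mv d 1 '' famAt d A k t i = famAt d A k (t + 1) i := by
  rw [famAt, famAt, mv_image_mv, min_eq_left h.le, min_eq_left (show t + 1 ≤ k i from h)]
  push_cast
  rfl

theorem famAt_succ {A : ℕ → Set (ℤ × ℤ)} {k : ℕ → ℕ} {t i : ℕ} (h : k i ≤ t) :
    famAt d A k (t + 1) i = famAt d A k t i := by
  rw [famAt, famAt, min_eq_right h, min_eq_right (by omega)]

theorem free_famAt {A : ℕ → Set (ℤ × ℤ)} {k : ℕ → ℕ} {t i : ℕ} (h : t < k i)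
    (hf : Free B o d (A i) (k i)) :
    ¬ Walled B o d (famAt d A k t i) ∧ ∀ c ∈ famAt d A k (t + 1) i, Inb B o c := by
  constructor
  · rintro ⟨_, ⟨c, hc, rfl⟩, hb⟩
    rw [mv_mv, min_eq_left h.le] at hb
    exact (hf t h c hc).2 hb
  · rintro _ ⟨c, hc, rfl⟩
    rw [min_eq_left (show t + 1 ≤ k i from h)]
    simpa using (hf t h c hc).1

theorem moveAll_famAt {I : Set ℕ} {A : ℕ → Set (ℤ × ℤ)} {k : ℕ → ℕ} {t : ℕ}
    (hf : ∀ i ∈ I, t < k i → Free B o d (A i) (k i))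
    (hw : ∀ i ∈ I, k i ≤ t → ∃ c ∈ A i, Blk B o (mv d (k i + 1) c)) :
    moveAll B o d (famAt d A k t '' I) = famAt d A k (t + 1) '' I := by
  ext X
  constructor
  · rintro (⟨⟨i, hi, rfl⟩, hX⟩ | ⟨_, ⟨i, hi, rfl⟩, hX, rfl, hb⟩)
    · rcases lt_or_ge t (k i) with h | h
      · exact absurd hX (free_famAt h (hf i hi h)).1
      · exact ⟨i, hi, famAt_succ h⟩
    · rcases lt_or_ge t (k i) with h | h
      · exact ⟨i, hi, (mv_famAt h).symm⟩
      · exact absurd (walled_famAt h (hw i hi h)) hX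
  · rintro ⟨i, hi, rfl⟩
    rcases lt_or_ge t (k i) with h | h
    · exact Or.inr ⟨_, ⟨i, hi, rfl⟩, (free_famAt h (hf i hi h)).1, (mv_famAt h).symm,
        (free_famAt h (hf i hi h)).2⟩
    · exact Or.inl ⟨⟨i, hi, (famAt_succ h).symm⟩, by
        rw [famAt_succ h]; exact walled_famAt h (hw i hi h)⟩

theorem iterate_step_famAt {I : Set ℕ} {A : ℕ → Set (ℤ × ℤ)} {k : ℕ → ℕ} (t₀ T : ℕ)
    (hf : ∀ i ∈ I, t₀ < k i → Free B o d (A i) (k i))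
    (hw : ∀ i ∈ I, k i < t₀ + T → ∃ c ∈ A i, Blk B o (mv d (k i + 1) c))
    (hs : ∀ t, t₀ ≤ t → t ≤ t₀ + T → FamApart I (famAt d A k t)) :
    (step selfAff d)^[T] (conf B o (famAt d A k t₀ '' I)) =
      conf B o (famAt d A k (t₀ + T) '' I) := by
  induction T with
  | zero => rfl
  | succ T ih =>
    rw [Function.iterate_succ_apply', ih (fun i hi h => hw i hi (by omega))
      (fun t h ht => hs t h (by omega)), step_conf (hs (t₀ + T) (by omega) (by omega)).separated,
      moveAll_famAt (fun i hi h => hf i hi (by omega)) (fun i hi h => hw i hi (by omega)),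
      mergeAll_of_separated (hs (t₀ + T + 1) (by omega) (by omega)).separated]
    rfl

/-- The start time `t₀` lets a tilt be resumed after a merge or a departure. Pieces that have
already stopped by then need no free path, only a wall in front of them. -/
theorem tilt_famAt {I : Set ℕ} {A : ℕ → Set (ℤ × ℤ)} {k : ℕ → ℕ} (t₀ T : ℕ)
    (hf : ∀ i ∈ I, t₀ < k i → Free B o d (A i) (k i))
    (hw : ∀ i ∈ I, ∃ c ∈ A i, Blk B o (mv d (k i + 1) c)) (hT : ∀ i ∈ I, k i ≤ t₀ + T)
    (hs : ∀ t, t₀ ≤ t → FamApart I (famAt d A k t)) :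
    Tilt selfAff d (conf B o (famAt d A k t₀ '' I)) (conf B o (famAt d A k (t₀ + T) '' I)) := by
  refine ⟨⟨T, iterate_step_famAt t₀ T hf (fun i hi _ => hw i hi) (fun t h _ => hs t h)⟩, ?_⟩
  apply step_conf_of_walled (hs _ (by omega)).separated
  rintro _ ⟨i, hi, rfl⟩
  exact walled_famAt (hT i hi) (hw i hi)

theorem Tilt.of_iterate {C C₁ C₂ : Config (Fin 1)} {k : ℕ}
    (h : (step selfAff d)^[k] C = C₁) (h' : Tilt selfAff d C₁ C₂) : Tilt selfAff d C C₂ := by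
  obtain ⟨⟨l, hl⟩, ht⟩ := h'
  refine ⟨⟨l + k, ?_⟩, ht⟩
  rw [Function.iterate_add_apply, h, hl]

/-! ### A shape, a single tile and a row of stored tiles -/

/-- The `j`-th tile of a store whose first tile is at `φ`. -/
def stored (φ : ℤ × ℤ) (j : ℕ) : ℤ × ℤ := (φ.1 - 4 * j, φ.2)

theorem mv_stored (t : ℤ) (φ : ℤ × ℤ) (j : ℕ) :
    mv d t (stored φ j) = stored (mv d t φ) j := by
  simp only [mv, stored, Prod.mk.injEq, and_true]
  ring

/-- The shape `S`, the tile at `q` and the store at `φ`, as an indexed family. -/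
def pieces (S : Set (ℤ × ℤ)) (q φ : ℤ × ℤ) : ℕ → Set (ℤ × ℤ)
  | 0 => S
  | 1 => {q}
  | j + 2 => {stored φ j}

/-- The configuration of the shape `S`, a tile at `q` and `m` stored tiles. -/
def withTile (B : Board) (o : ℤ × ℤ) (S : Set (ℤ × ℤ)) (q φ : ℤ × ℤ) (m : ℕ) : Config (Fin 1) :=
  conf B o (pieces S q φ '' {i | i < m + 2})

/-- The configuration of the shape `S` and `m` stored tiles. -/
def noTile (B : Board) (o : ℤ × ℤ) (S : Set (ℤ × ℤ)) (φ : ℤ × ℤ) (m : ℕ) : Config (Fin 1) :=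
  conf B o (pieces S (0, 0) φ '' {i | i < m + 2 ∧ i ≠ 1})

/-- Index `1` is excluded, so the placeholder `(0, 0)` for the travelling tile is immaterial. -/
theorem noTile_eq (S : Set (ℤ × ℤ)) (q φ : ℤ × ℤ) (m : ℕ) :
    noTile B o S φ m = conf B o (pieces S q φ '' {i | i < m + 2 ∧ i ≠ 1}) := by
  rw [noTile]
  congr 1
  refine Set.image_congr ?_
  rintro (_ | _ | i) ⟨_, h⟩
  · rfl
  · exact absurd rfl h
  · rfl

/-- Durations of the motions of the shape, the tile and the store. -/
def durations (k₀ k₁ k₂ : ℕ) : ℕ → ℕ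
  | 0 => k₀
  | 1 => k₁
  | _ + 2 => k₂

theorem famAt_pieces (S : Set (ℤ × ℤ)) (q φ : ℤ × ℤ) (k₀ k₁ k₂ t : ℕ) :
    famAt d (pieces S q φ) (durations k₀ k₁ k₂) t =
      pieces (mv d (min t k₀ : ℕ) '' S) (mv d (min t k₁ : ℕ) q) (mv d (min t k₂ : ℕ) φ) := by
  funext i
  rcases i with _ | _ | i
  · rfl
  · simp [famAt, pieces, durations]
  · simp [famAt, pieces, durations, mv_stored]

theorem stored_apart (φ : ℤ × ℤ) {i j : ℕ} (h : i ≠ j) : Apart (stored φ i) (stored φ j) := by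
  apply Apart.of_far
  simp only [stored]
  omega

theorem famApart_noTile {S : Set (ℤ × ℤ)} {q φ : ℤ × ℤ} {m : ℕ}
    (h : ∀ c ∈ S, ∀ j < m, Apart c (stored φ j)) :
    FamApart {i | i < m + 2 ∧ i ≠ 1} (pieces S q φ) := by
  rintro (_ | _ | i) ⟨hi, hi'⟩ (_ | _ | j) ⟨hj, hj'⟩ hij a ha b hb
  all_goals first | exact absurd rfl hij | exact absurd rfl hi' | exact absurd rfl hj' | skip
  · obtain rfl : b = _ := hb
    exact h a ha j (by omega)
  · obtain rfl : a = _ := ha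
    exact (h b hb i (by omega)).symm
  · obtain rfl : b = _ := hb
    obtain rfl : a = _ := ha
    exact stored_apart φ (by omega)

theorem famApart_withTile {S : Set (ℤ × ℤ)} {q φ : ℤ × ℤ} {m : ℕ}
    (h : ∀ c ∈ S, ∀ j < m, Apart c (stored φ j)) (h₁ : ∀ c ∈ S, Apart c q)
    (h₂ : ∀ j < m, Apart q (stored φ j)) :
    FamApart {i | i < m + 2} (pieces S q φ) := by
  have h₀ := famApart_noTile (q := q) h
  intro i hi j hj hij
  by_cases hi' : i = 1
  · subst hi'
    rintro a ha b hb
    obtain rfl : a = q := ha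
    rcases j with _ | _ | j
    · exact (h₁ b hb).symm
    · exact absurd rfl hij
    · obtain rfl : b = _ := hb
      exact h₂ j (by simpa using hj)
  by_cases hj' : j = 1
  · subst hj'
    rintro a ha b hb
    obtain rfl : b = q := hb
    rcases i with _ | _ | i
    · exact h₁ a ha
    · exact absurd rfl hij
    · obtain rfl : a = _ := ha
      exact (h₂ i (by simpa using hi)).symm
  exact h₀ i ⟨hi, hi'⟩ j ⟨hj, hj'⟩ hij

/-! ### Tilts of a shape, a store and at most one travelling tile. -/

section worlds

variable {S : Set (ℤ × ℤ)} {q φ : ℤ × ℤ} {m k₀ k₁ k₂ : ℕ}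

theorem tilt_noTile (r₀ : Run B o d S k₀) (r₂ : ∀ j < m, Run B o d {stored φ j} k₂)
    (h : ∀ t : ℕ, ∀ c ∈ S, ∀ j < m,
      Apart (mv d (min t k₀ : ℕ) c) (mv d (min t k₂ : ℕ) (stored φ j))) :
    Tilt selfAff d (noTile B o S φ m) (noTile B o (mv d k₀ '' S) (mv d k₂ φ) m) := by
  have := tilt_famAt (B := B) (o := o) (d := d) (I := {i | i < m + 2 ∧ i ≠ 1})
    (A := pieces S (0, 0) φ) (k := durations k₀ 0 k₂) 0 (max k₀ k₂) ?_ ?_ ?_ ?_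
  · rw [zero_add, famAt_zero, famAt_pieces, ← noTile_eq, ← noTile_eq] at this
    simpa using this
  · rintro (_ | _ | i) ⟨hi, hi'⟩ _
    · exact r₀.1
    · exact absurd rfl hi'
    · exact (r₂ i (by omega)).1
  · rintro (_ | _ | i) ⟨hi, hi'⟩
    · exact r₀.2
    · exact absurd rfl hi'
    · exact (r₂ i (by omega)).2
  · rintro (_ | _ | i) _ <;> simp [durations]
  · intro t _
    rw [famAt_pieces]
    apply famApart_noTile
    rintro _ ⟨c, hc, rfl⟩ j hj
    rw [← mv_stored]
    exact h t c hc j hj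

theorem tilt_withTile (r₀ : Run B o d S k₀) (r₁ : Run B o d {q} k₁)
    (r₂ : ∀ j < m, Run B o d {stored φ j} k₂)
    (h : ∀ t : ℕ, ∀ c ∈ S, ∀ j < m,
      Apart (mv d (min t k₀ : ℕ) c) (mv d (min t k₂ : ℕ) (stored φ j)))
    (h₁ : ∀ t : ℕ, ∀ c ∈ S, Apart (mv d (min t k₀ : ℕ) c) (mv d (min t k₁ : ℕ) q))
    (h₂ : ∀ t : ℕ, ∀ j < m, Apart (mv d (min t k₁ : ℕ) q) (mv d (min t k₂ : ℕ) (stored φ j))) :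
    Tilt selfAff d (withTile B o S q φ m)
      (withTile B o (mv d k₀ '' S) (mv d k₁ q) (mv d k₂ φ) m) := by
  have := tilt_famAt (B := B) (o := o) (d := d) (I := {i | i < m + 2})
    (A := pieces S q φ) (k := durations k₀ k₁ k₂) 0 (max k₀ (max k₁ k₂)) ?_ ?_ ?_ ?_
  · rw [zero_add, famAt_zero, famAt_pieces] at this
    simpa [withTile] using this
  · rintro (_ | _ | i) hi _
    · exact r₀.1
    · exact r₁.1
    · exact (r₂ i (by simpa using hi)).1
  · rintro (_ | _ | i) hi
    · exact r₀.2
    · exact r₁.2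
    · exact (r₂ i (by simpa using hi)).2
  · rintro (_ | _ | i) _ <;> simp [durations]
  · intro t _
    rw [famAt_pieces]
    apply famApart_withTile
    · rintro _ ⟨c, hc, rfl⟩ j hj
      rw [← mv_stored]
      exact h t c hc j hj
    · rintro _ ⟨c, hc, rfl⟩
      exact h₁ t c hc
    · intro j hj
      rw [← mv_stored]
      exact h₂ t j hj

/-- The tilt splits at time `K`: before it all pieces are apart, at it the tile merges with the
shape, which is already at rest because `k₀ < K`, and afterwards only the store may still move. -/
theorem tilt_drop {K : ℕ} (r₀ : Run B o d S k₀) (f₁ : Free B o d {q} K) (hK : k₀ < K)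
    (r₂ : ∀ j < m, Run B o d {stored φ j} k₂)
    (h : ∀ t : ℕ, ∀ c ∈ S, ∀ j < m,
      Apart (mv d (min t k₀ : ℕ) c) (mv d (min t k₂ : ℕ) (stored φ j)))
    (h₁ : ∀ t : ℕ, t < K → ∀ c ∈ S, Apart (mv d (min t k₀ : ℕ) c) (mv d (t : ℕ) q))
    (h₂ : ∀ t : ℕ, ∀ j < m, Apart (mv d (min t K : ℕ) q) (mv d (min t k₂ : ℕ) (stored φ j)))
    (hadj : ∃ c ∈ S, Adjacent (mv d k₀ c) (mv d K q)) :
    Tilt selfAff d (withTile B o S q φ m)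
      (noTile B o (insert (mv d K q) (mv d k₀ '' S)) (mv d k₂ φ) m) := by
  obtain ⟨T, rfl⟩ : ∃ T, K = T + 1 := ⟨K - 1, by omega⟩
  have hap : ∀ t ≤ T, FamApart {i | i < m + 2}
      (famAt d (pieces S q φ) (durations k₀ (T + 1) k₂) t) := by
    intro t ht
    rw [famAt_pieces]
    apply famApart_withTile
    · rintro _ ⟨c, hc, rfl⟩ j hj
      rw [← mv_stored]
      exact h t c hc j hj
    · rintro _ ⟨c, hc, rfl⟩
      have := h₁ t (by omega) c hc
      rwa [min_eq_left (show t ≤ T + 1 by omega)]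
    · intro j hj
      rw [← mv_stored]
      exact h₂ t j hj
  have hf : ∀ i ∈ {i | i < m + 2}, Free B o d (pieces S q φ i) (durations k₀ (T + 1) k₂ i) := by
    rintro (_ | _ | i) hi
    · exact r₀.1
    · exact f₁
    · exact (r₂ i (by simpa using hi)).1
  have hw : ∀ i ∈ {i | i < m + 2}, durations k₀ (T + 1) k₂ i ≤ T →
      ∃ c ∈ pieces S q φ i, Blk B o (mv d (durations k₀ (T + 1) k₂ i + 1) c) := by
    rintro (_ | _ | i) hi hi'
    · exact r₀.2
    · simp [durations] at hi'
    · exact (r₂ i (by simpa using hi)).2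
  have e1 := iterate_step_famAt (B := B) (o := o) (d := d) (I := {i | i < m + 2})
    (A := pieces S q φ) (k := durations k₀ (T + 1) k₂) 0 T (fun i hi _ => hf i hi)
    (fun i hi h => hw i hi (by omega)) (fun t _ ht => hap t (by omega))
  rw [zero_add, famAt_zero] at e1
  have himg : famAt d (pieces S q φ) (durations k₀ (T + 1) k₂) (T + 1) '' {i | i < m + 2} =
      insert (mv d k₀ '' S) (insert {mv d (T + 1 : ℕ) q}
        ((fun j : ℕ => ({stored (mv d (min (T + 1) k₂ : ℕ) φ) j} : Set (ℤ × ℤ))) ''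
          {j | j < m})) := by
    rw [famAt_pieces, min_eq_right hK.le, min_self]
    ext X
    constructor
    · rintro ⟨_ | _ | i, hi, rfl⟩
      · exact Or.inl rfl
      · exact Or.inr (Or.inl rfl)
      · exact Or.inr (Or.inr ⟨i, by simpa using hi, rfl⟩)
    · rintro (rfl | rfl | ⟨i, hi, rfl⟩)
      · exact ⟨0, by simp, rfl⟩
      · exact ⟨1, by simp, rfl⟩
      · exact ⟨i + 2, by simpa using hi, rfl⟩
  have e2 : (step selfAff d)^[T + 1] (withTile B o S q φ m) =
      noTile B o (insert (mv d (T + 1 : ℕ) q) (mv d k₀ '' S)) (mv d (min (T + 1) k₂ : ℕ) φ) m := by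
    rw [Function.iterate_succ_apply', withTile, e1, step_conf (hap T le_rfl).separated,
      moveAll_famAt (fun i hi _ => hf i hi) hw, himg, mergeAll_insert_insert]
    · rw [noTile, conf]
      congr 2
      ext X
      constructor
      · rintro (rfl | ⟨i, hi, rfl⟩)
        · exact ⟨0, by simp, by simp [pieces]⟩
        · exact ⟨i + 2, by simpa using hi, rfl⟩
      · rintro ⟨_ | _ | i, ⟨hi, hi'⟩, rfl⟩
        · left; simp [pieces]
        · exact absurd rfl hi'
        · exact Or.inr ⟨i, by simpa using hi, rfl⟩
    · rintro _ ⟨i, _, rfl⟩ _ ⟨j, _, rfl⟩ hij a rfl b rfl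
      exact stored_apart _ (fun e => hij (by rw [e]))
    · rintro _ ⟨j, hj, rfl⟩ a rfl b (⟨c, hc, rfl⟩ | rfl)
      · have := h (T + 1) c hc j hj
        rw [min_eq_right hK.le, mv_stored] at this
        exact this.symm
      · have := h₂ (T + 1) j hj
        rw [min_self, mv_stored] at this
        exact this.symm
    · obtain ⟨c, hc, hca⟩ := hadj
      exact ⟨_, ⟨c, hc, rfl⟩, _, rfl, hca⟩
  refine Tilt.of_iterate e2 ?_
  -- The merged shape is pulled back by `k₀`, so that it becomes the time-`T + 1` state of a family
  -- in which it has duration `k₀`, and the general tilt lemma applies from that time on.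
  set S' := insert (mv d (T + 1 - k₀ : ℤ) q) S with hS'
  have hS0 : insert (mv d (T + 1 : ℕ) q) (mv d k₀ '' S) = mv d k₀ '' S' := by
    rw [hS', Set.image_insert_eq, mv_mv]
    congr 2
    push_cast
    ring
  have := tilt_famAt (B := B) (o := o) (d := d) (I := {i | i < m + 2 ∧ i ≠ 1})
    (A := pieces S' (0, 0) φ) (k := durations k₀ 0 k₂) (T + 1) k₂ ?_ ?_ ?_ ?_
  · rw [famAt_pieces, famAt_pieces, ← noTile_eq, ← noTile_eq, min_eq_right hK.le,
      min_eq_right (show k₀ ≤ T + 1 + k₂ by omega),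
      min_eq_right (show k₂ ≤ T + 1 + k₂ by omega), ← hS0] at this
    exact this
  · rintro (_ | _ | i) ⟨hi, hi'⟩ ht
    · exact absurd ht (by simp [durations]; omega)
    · exact absurd rfl hi'
    · exact (r₂ i (by omega)).1
  · rintro (_ | _ | i) ⟨hi, hi'⟩
    · obtain ⟨c, hc, hb⟩ := r₀.2
      exact ⟨c, Or.inr hc, hb⟩
    · exact absurd rfl hi'
    · exact (r₂ i (by omega)).2
  · rintro (_ | _ | i) _ <;> simp [durations]
    omega
  · intro t ht
    rw [famAt_pieces]
    apply famApart_noTile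
    rw [min_eq_right (show k₀ ≤ t by omega), ← hS0]
    rintro _ (rfl | ⟨c, hc, rfl⟩) j hj
    · have := h₂ t j hj
      rwa [min_eq_right ht, mv_stored] at this
    · have := h t c hc j hj
      rwa [min_eq_right (show k₀ ≤ t by omega), mv_stored] at this

/-- At step `K + 1` the tile is neither walled nor still on the board, so that step deletes index
`1`; the other pieces continue as if it had never been there. -/
theorem tilt_exit {K : ℕ} (r₀ : Run B o d S k₀) (f₁ : Free B o d {q} K)
    (hb : ¬ Blk B o (mv d (K + 1) q)) (hi : ¬ Inb B o (mv d (K + 1) q))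
    (r₂ : ∀ j < m, Run B o d {stored φ j} k₂)
    (h : ∀ t : ℕ, ∀ c ∈ S, ∀ j < m,
      Apart (mv d (min t k₀ : ℕ) c) (mv d (min t k₂ : ℕ) (stored φ j)))
    (h₁ : ∀ t : ℕ, ∀ c ∈ S, Apart (mv d (min t k₀ : ℕ) c) (mv d (min t K : ℕ) q))
    (h₂ : ∀ t : ℕ, ∀ j < m, Apart (mv d (min t K : ℕ) q) (mv d (min t k₂ : ℕ) (stored φ j))) :
    Tilt selfAff d (withTile B o S q φ m) (noTile B o (mv d k₀ '' S) (mv d k₂ φ) m) := by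
  have hap : ∀ t, FamApart {i | i < m + 2}
      (famAt d (pieces S q φ) (durations k₀ K k₂) t) := by
    intro t
    rw [famAt_pieces]
    apply famApart_withTile
    · rintro _ ⟨c, hc, rfl⟩ j hj
      rw [← mv_stored]
      exact h t c hc j hj
    · rintro _ ⟨c, hc, rfl⟩
      exact h₁ t c hc
    · intro j hj
      rw [← mv_stored]
      exact h₂ t j hj
  have hap' : ∀ t, FamApart {i | i < m + 2 ∧ i ≠ 1}
      (famAt d (pieces S q φ) (durations k₀ K k₂) t) :=
    fun t i hi j hj => hap t i hi.1 j hj.1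
  have hf : ∀ i ∈ {i | i < m + 2}, Free B o d (pieces S q φ i) (durations k₀ K k₂ i) := by
    rintro (_ | _ | i) hi
    · exact r₀.1
    · exact f₁
    · exact (r₂ i (by simpa using hi)).1
  have hw : ∀ i ∈ {i | i < m + 2 ∧ i ≠ 1},
      ∃ c ∈ pieces S q φ i, Blk B o (mv d (durations k₀ K k₂ i + 1) c) := by
    rintro (_ | _ | i) ⟨hi, hi'⟩
    · exact r₀.2
    · exact absurd rfl hi'
    · exact (r₂ i (by omega)).2
  have e1 := iterate_step_famAt (B := B) (o := o) (d := d) (I := {i | i < m + 2})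
    (A := pieces S q φ) (k := durations k₀ K k₂) 0 K (fun i hi _ => hf i hi)
    (fun i hi h => hw i ⟨hi, by rintro rfl; simp [durations] at h⟩) (fun t _ _ => hap t)
  rw [zero_add, famAt_zero] at e1
  have hsplit : ∀ f : ℕ → Set (ℤ × ℤ), f '' {i | i < m + 2} =
      f '' {i | i < m + 2 ∧ i ≠ 1} ∪ {f 1} := by
    intro f
    rw [← Set.image_singleton, ← Set.image_union]
    congr 1
    ext i
    simp only [Set.mem_ofPred_eq, Set.mem_union, Set.mem_singleton_iff]
    omega
  have hmove : moveAll B o d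
      (famAt d (pieces S q φ) (durations k₀ K k₂) K '' {i | i < m + 2}) =
      famAt d (pieces S q φ) (durations k₀ K k₂) (K + 1) '' {i | i < m + 2 ∧ i ≠ 1} := by
    rw [← moveAll_famAt (fun i hi _ => hf i hi.1) (fun i hi _ => hw i hi), hsplit]
    have h1 : famAt d (pieces S q φ) (durations k₀ K k₂) K 1 = {mv d K q} := by
      rw [famAt_pieces, min_self]; rfl
    rw [h1]
    ext X
    constructor
    · rintro (⟨hX | rfl, hX'⟩ | ⟨Y, hY | rfl, hY', rfl, hXb⟩)
      · exact Or.inl ⟨hX, hX'⟩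
      · obtain ⟨_, rfl, hc⟩ := hX'
        rw [mv_mv] at hc
        exact absurd hc hb
      · exact Or.inr ⟨Y, hY, hY', rfl, hXb⟩
      · have := hXb _ ⟨_, rfl, rfl⟩
        rw [mv_mv] at this
        exact absurd this hi
    · rintro (⟨hX, hX'⟩ | ⟨Y, hY, hY', rfl, hXb⟩)
      · exact Or.inl ⟨Or.inl hX, hX'⟩
      · exact Or.inr ⟨Y, Or.inl hY, hY', rfl, hXb⟩
  have e2 : (step selfAff d)^[K + 1] (withTile B o S q φ m) =
      conf B o (famAt d (pieces S q φ) (durations k₀ K k₂) (K + 1) ''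
        {i | i < m + 2 ∧ i ≠ 1}) := by
    rw [Function.iterate_succ_apply', withTile, e1, step_conf (hap K).separated, hmove,
      mergeAll_of_separated (hap' _).separated]
    rfl
  refine Tilt.of_iterate e2 ?_
  have := tilt_famAt (B := B) (o := o) (d := d) (I := {i | i < m + 2 ∧ i ≠ 1})
    (A := pieces S q φ) (k := durations k₀ K k₂) (K + 1) (max k₀ k₂)
    (fun i hi _ => hf i hi.1) hw ?_ (fun t _ => hap' t)
  · rw [famAt_pieces _ _ _ _ _ _ (K + 1 + max k₀ k₂), ← noTile_eq] at this
    rwa [min_eq_right (show k₀ ≤ K + 1 + max k₀ k₂ by omega),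
      min_eq_right (show k₂ ≤ K + 1 + max k₀ k₂ by omega)] at this
  · rintro (_ | _ | i) ⟨_, hi'⟩
    · simp only [durations]; omega
    · exact absurd rfl hi'
    · simp only [durations]; omega

end worlds

end TiltAssembly

namespace TiltAssembly

/-! ### The board -/

/-- The open cells of the board, in coordinates in which the room of the shape has its lower left
corner at the origin. `upper`, `jog`, `right`, `lower` and `left` form the room; `lane*`, `field*`,
`wedgeN` and `entryW` lead from the shafts into the room; `climb` is the staircase above the
shafts, and `store` the reservoir of tiles. -/
inductive Open (n M : ℤ) : ℤ → ℤ → Prop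
  | upper {x y} (h : 0 ≤ x ∧ x ≤ 2 * n - 1 ∧ n + 1 ≤ y ∧ y ≤ 3 * n) : Open n M x y
  | jog {x y} (h : 0 ≤ x ∧ x ≤ 3 * n ∧ n + 1 ≤ y ∧ y ≤ 2 * n) : Open n M x y
  | right {x y} (h : 2 * n + 1 ≤ x ∧ x ≤ 3 * n ∧ 0 ≤ y ∧ y ≤ 2 * n) : Open n M x y
  | lower {x y} (h : 0 ≤ x ∧ x ≤ 3 * n ∧ 0 ≤ y ∧ y ≤ n - 1) : Open n M x y
  | left {x y} (h : 0 ≤ x ∧ x ≤ n - 1 ∧ 0 ≤ y ∧ y ≤ 3 * n) : Open n M x y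
  | laneN {x y} (h : 2 * n + 1 ≤ x ∧ x ≤ 3 * n ∧ 2 * n + 1 ≤ y ∧ x + y ≤ 6 * n + 2) : Open n M x y
  | wedgeN {x y} (h : x ≤ 2 * n ∧ y ≤ 4 * n + 1 ∧ 4 * n + 2 ≤ y + x / 2) : Open n M x y
  | fieldE {x y} (h : 3 * n + 1 ≤ x ∧ x ≤ 6 * n ∧ 0 ≤ y ∧ y ≤ n - 1 ∧
      (x + 1) / 2 ≤ y + 2 * n + 1) : Open n M x y
  | fieldS {x y} (h : n ≤ x ∧ x ≤ 8 * n ∧ -n - 1 ≤ y ∧ y ≤ -2 ∧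
      (x + 1) / 2 ≤ y + 4 * n + 2) : Open n M x y
  | laneS {x y} (h : 0 ≤ x ∧ x ≤ n - 1 ∧ y ≤ -1 ∧ -2 ≤ x + y) : Open n M x y
  | fieldW {x y} (h : -1 ≤ x ∧ x ≤ 10 * n ∧ -2 * n - 2 ≤ y ∧ y ≤ -n - 3 ∧
      (x + 1) / 2 ≤ y + 6 * n + 3) : Open n M x y
  | laneW {x y} (h : -n - 1 ≤ x ∧ x ≤ -2 ∧ -2 * n - 4 ≤ x + y ∧ y ≤ 3 * n + 2 + x) : Open n M x y
  | entryW {x y} (h : x = -1 ∧ 2 * n + 1 ≤ y ∧ y ≤ 3 * n) : Open n M x y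
  | climb {x y} (h : 0 ≤ x ∧ x ≤ 10 * n + 2 ∧ 5 * n + 5 + (x + 1) / 2 ≤ y ∧
      y ≤ 5 * n + 6 + x / 2) : Open n M x y
  | shaftN {x y} (h : 2 ≤ x ∧ x ≤ 2 * n ∧ x % 2 = 0 ∧ 4 * n + 2 ≤ y ∧
      y ≤ 5 * n + 5 + x / 2) : Open n M x y
  | shaftE {x y} (h : 4 * n + 2 ≤ x ∧ x ≤ 6 * n ∧ x % 2 = 0 ∧ x / 2 ≤ y + 2 * n + 1 ∧
      y ≤ 5 * n + 5 + x / 2) : Open n M x y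
  | shaftS {x y} (h : 6 * n + 2 ≤ x ∧ x ≤ 8 * n ∧ x % 2 = 0 ∧ x / 2 ≤ y + 4 * n + 2 ∧
      y ≤ 5 * n + 5 + x / 2) : Open n M x y
  | shaftW {x y} (h : 8 * n + 2 ≤ x ∧ x ≤ 10 * n ∧ x % 2 = 0 ∧ x / 2 ≤ y + 6 * n + 3 ∧
      y ≤ 5 * n + 5 + x / 2) : Open n M x y
  | shaftOut {x y} (h : x = 10 * n + 2 ∧ -2 * n - 3 ≤ y ∧ y ≤ 10 * n + 6) : Open n M x y
  | store {x y} (h : -4 * M ≤ x ∧ x ≤ -1 ∧ ((x % 4 = 0 ∧ 5 * n + 4 ≤ y ∧ y ≤ 5 * n + 5) ∨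
      (x % 4 = 1 ∧ y = 5 * n + 4) ∨ (x % 4 = 2 ∧ 5 * n + 3 ≤ y ∧ y ≤ 5 * n + 5) ∨
      (x % 4 = 3 ∧ y = 5 * n + 5))) : Open n M x y

/-- The position of the local origin on the board. -/
def origin (n M : ℕ) : ℤ × ℤ := (4 * M + n + 5, 2 * n + 4)

/-- The board for shapes of width and height at most `n` and `M` tiles. -/
def theBoard (n M : ℕ) : Board where
  m := 4 * M + 11 * n + 9
  n := 12 * n + 12
  blocked := {p | p ∈ box (4 * M + 11 * n + 9) (12 * n + 12) ∧
    ¬ Open n M (p.1 - (4 * M + n + 5)) (p.2 - (2 * n + 4))}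
  blocked_subset := fun _ h => h.1

variable {n M : ℕ} {d : Dir}

theorem inb_iff (c : ℤ × ℤ) : Inb (theBoard n M) (origin n M) c ↔
    (-4 * M - n - 4 ≤ c.1 ∧ c.1 ≤ 10 * n + 4) ∧ -2 * n - 3 ≤ c.2 ∧ c.2 ≤ (10 * n + 8 : ℤ) := by
  simp only [Inb, theBoard, origin, box, Set.mem_prod, Set.mem_Icc, Prod.fst_add, Prod.snd_add]
  push_cast
  constructor <;> rintro ⟨⟨_, _⟩, _, _⟩ <;> refine ⟨⟨?_, ?_⟩, ?_, ?_⟩ <;> omega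

theorem blk_iff (c : ℤ × ℤ) : Blk (theBoard n M) (origin n M) c ↔
    Inb (theBoard n M) (origin n M) c ∧ ¬ Open n M c.1 c.2 := by
  simp only [Blk, Inb, theBoard, origin, Set.mem_ofPred_eq, Prod.fst_add, Prod.snd_add,
    add_sub_cancel_right]

theorem Open.inb (hn : 0 < n) {c : ℤ × ℤ} (h : Open n M c.1 c.2) :
    Inb (theBoard n M) (origin n M) c := by
  rw [inb_iff]
  cases h <;> omega

theorem Open.free (hn : 0 < n) {c : ℤ × ℤ} (h : Open n M c.1 c.2) :
    Inb (theBoard n M) (origin n M) c ∧ ¬ Blk (theBoard n M) (origin n M) c :=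
  ⟨h.inb hn, fun h' => ((blk_iff c).1 h').2 h⟩

/-- The set `S` translated by `v`. -/
def place (S : Set (ℤ × ℤ)) (v : ℤ × ℤ) : Set (ℤ × ℤ) := (fun p => p + v) '' S

theorem mv_place (d : Dir) (t : ℤ) (S : Set (ℤ × ℤ)) (v : ℤ × ℤ) :
    mv d t '' place S v = place S (mv d t v) := by
  rw [place, place, Set.image_image]
  simp only [mv_add_left]

/-- `S` has the bounding box `[x₀, x₁] × [y₀, y₁]`, of width and height at most `n`. -/
structure Bounds (n : ℕ) (S : Set (ℤ × ℤ)) (x₀ x₁ y₀ y₁ : ℤ) : Prop where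
  mem : ∀ c ∈ S, x₀ ≤ c.1 ∧ c.1 ≤ x₁ ∧ y₀ ≤ c.2 ∧ c.2 ≤ y₁
  left : ∃ c ∈ S, c.1 = x₀
  right : ∃ c ∈ S, c.1 = x₁
  bottom : ∃ c ∈ S, c.2 = y₀
  top : ∃ c ∈ S, c.2 = y₁
  width : x₁ - x₀ ≤ n - 1
  height : y₁ - y₀ ≤ n - 1

/-! ### Motions of the shape, of a tile and of the store -/

/-- The shape `S` moves from `v` to `v'` by `k` units, and stays in the room. -/
structure ShapeMove (n M : ℕ) (d : Dir) (S : Set (ℤ × ℤ)) (v v' : ℤ × ℤ) (k : ℕ) : Prop where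
  eq : mv d k v = v'
  run : Run (theBoard n M) (origin n M) d (place S v) k
  room : ∀ t : ℕ, t ≤ k → ∀ c ∈ place S v, (0 ≤ (mv d t c).1 ∧ (mv d t c).1 ≤ 3 * n) ∧
    0 ≤ (mv d t c).2 ∧ (mv d t c).2 ≤ 3 * n

/-- A store of `m` tiles moves from `φ` to `φ'` by `k` units, and stays left of `X`. -/
structure StoreMove (n M : ℕ) (d : Dir) (m : ℕ) (X : ℤ) (φ φ' : ℤ × ℤ) (k : ℕ) : Prop where
  eq : mv d k φ = φ'
  run : ∀ j < m, Run (theBoard n M) (origin n M) d {stored φ j} k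
  range : ∀ t : ℕ, t ≤ k → (mv d t φ).1 ≤ X ∧ 5 * n + 3 ≤ (mv d t φ).2

/-- A tile that moves by `k` units from `q` keeps away from a store left of `X`. -/
def Clear (n : ℕ) (d : Dir) (X : ℤ) (q : ℤ × ℤ) (k : ℕ) : Prop :=
  ∀ t : ℕ, t ≤ k → X + 2 ≤ (mv d t q).1 ∨ (mv d t q).2 ≤ 4 * n + 1

/-- A tile that moves by `k` units from `q` keeps away from the room. -/
def Outside (n : ℕ) (d : Dir) (q : ℤ × ℤ) (k : ℕ) : Prop :=
  ∀ t : ℕ, t ≤ k → 3 * n + 2 ≤ (mv d t q).1 ∨ (mv d t q).1 ≤ -2 ∨ 3 * n + 2 ≤ (mv d t q).2 ∨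
    (mv d t q).2 ≤ -2

/-- A tile moves from `q` to `q'` by `k` units, away from the room and the store. -/
structure TileMove (n M : ℕ) (d : Dir) (X : ℤ) (q q' : ℤ × ℤ) (k : ℕ) : Prop where
  eq : mv d k q = q'
  run : Run (theBoard n M) (origin n M) d {q} k
  clear : Clear n d X q k
  outside : Outside n d q k

/-! ### Combining simultaneous motions into tilts. -/

section combine

variable {S : Set (ℤ × ℤ)} {v v' q q' φ φ' : ℤ × ℤ} {m k₀ k₁ k₂ : ℕ} {X : ℤ}

theorem apart_shape_store (hs : ShapeMove n M d S v v' k₀)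
    (hφ : StoreMove n M d m X φ φ' k₂) (t : ℕ) (c : ℤ × ℤ) (hc : c ∈ place S v) (j : ℕ) :
    Apart (mv d (min t k₀ : ℕ) c) (mv d (min t k₂ : ℕ) (stored φ j)) := by
  have h1 := hs.room (min t k₀) (min_le_right _ _) c hc
  have h2 := hφ.range (min t k₂) (min_le_right _ _)
  apply Apart.of_far
  rw [mv_stored]
  simp only [stored]
  omega

theorem apart_tile_store (hq : Clear n d X q k₁)
    (hφ : StoreMove n M d m X φ φ' k₂) (t : ℕ) (j : ℕ) :
    Apart (mv d (min t k₁ : ℕ) q) (mv d (min t k₂ : ℕ) (stored φ j)) := by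
  have h1 := hq (min t k₁) (min_le_right _ _)
  have h2 := hφ.range (min t k₂) (min_le_right _ _)
  apply Apart.of_far
  rw [mv_stored]
  simp only [stored]
  omega

theorem apart_shape_tile (hs : ShapeMove n M d S v v' k₀) (hq : Outside n d q k₁)
    (t : ℕ) (c : ℤ × ℤ) (hc : c ∈ place S v) :
    Apart (mv d (min t k₀ : ℕ) c) (mv d (min t k₁ : ℕ) q) := by
  have h1 := hs.room (min t k₀) (min_le_right _ _) c hc
  have h2 := hq (min t k₁) (min_le_right _ _)
  apply Apart.of_far
  omega

theorem ShapeMove.tilt (hs : ShapeMove n M d S v v' k₀)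
    (hφ : StoreMove n M d m X φ φ' k₂) :
    Tilt selfAff d (noTile (theBoard n M) (origin n M) (place S v) φ m)
      (noTile (theBoard n M) (origin n M) (place S v') φ' m) := by
  have := tilt_noTile hs.run hφ.run fun t c hc j _ => apart_shape_store hs hφ t c hc j
  rwa [mv_place, hs.eq, hφ.eq] at this

theorem TileMove.tilt (hs : ShapeMove n M d S v v' k₀)
    (hφ : StoreMove n M d m X φ φ' k₂) (hq : TileMove n M d X q q' k₁) :
    Tilt selfAff d (withTile (theBoard n M) (origin n M) (place S v) q φ m)
      (withTile (theBoard n M) (origin n M) (place S v') q' φ' m) := by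
  have := tilt_withTile hs.run hq.run hφ.run
    (fun t c hc j _ => apart_shape_store hs hφ t c hc j)
    (fun t c hc => apart_shape_tile hs hq.outside t c hc)
    (fun t j _ => apart_tile_store hq.clear hφ t j)
  rwa [mv_place, hs.eq, hφ.eq, hq.eq] at this

theorem exit_tilt (hs : ShapeMove n M d S v v' k₀)
    (hφ : StoreMove n M d m X φ φ' k₂)
    (hf : Free (theBoard n M) (origin n M) d {q} k₁) (hc : Clear n d X q k₁)
    (ho : Outside n d q k₁) (hi : ¬ Inb (theBoard n M) (origin n M) (mv d (k₁ + 1) q)) :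
    Tilt selfAff d (withTile (theBoard n M) (origin n M) (place S v) q φ m)
      (noTile (theBoard n M) (origin n M) (place S v') φ' m) := by
  have := tilt_exit hs.run hf (fun h => hi ((blk_iff _).1 h).1) hi hφ.run
    (fun t c hc j _ => apart_shape_store hs hφ t c hc j)
    (fun t c hc => apart_shape_tile hs ho t c hc)
    (fun t j _ => apart_tile_store hc hφ t j)
  rwa [mv_place, hs.eq, hφ.eq] at this

/-- A tile arriving out of direction `e` travels in the opposite direction `d`, so positions before
impact are negative multiples of `d`. -/
theorem CanDrop.apart {e : Dir} (he : e.vec = -d.vec) {p : ℤ × ℤ} (hp : CanDrop S e p)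
    {i : ℕ} (hi : 0 < i) {c : ℤ × ℤ} (hc : c ∈ S) : Apart c (mv d (-i) p) := by
  have e1 : mv d (-i) p = p + i • e.vec := by
    rw [he]
    ext <;> simp [mv]
  rw [e1]
  obtain ⟨h1, h2⟩ := hp.2 i hi
  exact ⟨fun h => h1 (h ▸ hc), fun h => h2 c hc (adjacent_comm.1 h)⟩

/-- Relative to the shape the tile is always on the half-line leading to `p`, so `CanDrop` supplies
both the separation before impact and the contact at impact. -/
theorem drop_tilt (hs : ShapeMove n M d S v v' k₀)
    (hφ : StoreMove n M d m X φ φ' k₂) {e : Dir} (he : e.vec = -d.vec) {p : ℤ × ℤ}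
    (hp : CanDrop S e p) (hq : mv d k₁ q = p + v') (hk : k₀ < k₁)
    (hf : Free (theBoard n M) (origin n M) d {q} k₁) (hc : Clear n d X q k₁) :
    Tilt selfAff d (withTile (theBoard n M) (origin n M) (place S v) q φ m)
      (noTile (theBoard n M) (origin n M) (place (insert p S) v') φ' m) := by
  have key : ∀ i : ℕ, 0 < i → ∀ c ∈ S, Apart (c + v') (mv d (k₁ - i) q) := by
    intro i hi c hc
    have h1 := (apart_mv d 0 _ _).2 (CanDrop.apart he hp hi hc)
    have h2 : mv d (k₁ - i) q = mv d (-i) p + v' := by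
      rw [← mv_add, ← hq, mv_mv]; rfl
    rw [h2]
    rw [mv_zero, mv_zero] at h1
    exact ⟨fun h => h1.1 (add_right_cancel h), fun h => h1.2 ((adjacent_add _ _ _).1 h)⟩
  have := tilt_drop hs.run hf hk hφ.run
    (fun t c hc j _ => apart_shape_store hs hφ t c hc j) ?_
    (fun t j _ => apart_tile_store hc hφ t j) ?_
  · rw [mv_place, hs.eq, hφ.eq, hq] at this
    convert this using 2
    rw [place, place, Set.image_insert_eq]
  · rintro t ht _ ⟨c, hc, rfl⟩
    -- While both move the gap stays at `k₁ - k₀`; once the shape rests, the gap is `k₁ - t`.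
    rcases le_total t k₀ with h | h
    · rw [min_eq_left h, ← apart_mv d (k₀ - t), mv_mv, mv_mv]
      have := key (k₁ - k₀) (by omega) c hc
      rw [← hs.eq, ← mv_add_left] at this
      push_cast [hk.le] at this
      convert this using 2 <;> ring
    · rw [min_eq_right h, mv_add_left, hs.eq]
      have := key (k₁ - t) (by omega) c hc
      push_cast [ht.le] at this
      convert this using 2
      ring
  · obtain ⟨c, hc, hca⟩ := hp.1.2
    refine ⟨_, ⟨c, hc, rfl⟩, ?_⟩
    simp only [mv_add_left, hs.eq, hq, adjacent_add]
    exact adjacent_comm.1 hca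

end combine

/-! ### Motions on the board -/

theorem free_singleton (hn : 0 < n) {q : ℤ × ℤ} {k : ℕ}
    (h : ∀ t : ℤ, 1 ≤ t → t ≤ k → Open n M (mv d t q).1 (mv d t q).2) :
    Free (theBoard n M) (origin n M) d {q} k := by
  rintro t ht _ rfl
  exact (h (t + 1) (by omega) (by omega)).free hn

theorem run_singleton (hn : 0 < n) {q : ℤ × ℤ} {k : ℕ}
    (h : ∀ t : ℤ, 1 ≤ t → t ≤ k → Open n M (mv d t q).1 (mv d t q).2)
    (hi : Inb (theBoard n M) (origin n M) (mv d (k + 1) q))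
    (hb : ¬ Open n M (mv d (k + 1) q).1 (mv d (k + 1) q).2) :
    Run (theBoard n M) (origin n M) d {q} k :=
  ⟨free_singleton hn h, q, rfl, (blk_iff _).2 ⟨hi, hb⟩⟩

theorem exists_natCast {z : ℤ} (h : 0 ≤ z) : ∃ k : ℕ, (k : ℤ) = z :=
  ⟨z.toNat, Int.toNat_of_nonneg h⟩

/-! ### The circuit of the shape through its room. -/

section shape

variable {S : Set (ℤ × ℤ)} {x₀ x₁ y₀ y₁ : ℤ}

theorem shapeMove_of (hn : 0 < n) {v v' : ℤ × ℤ} {k : ℕ} (hS : Bounds n S x₀ x₁ y₀ y₁)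
    (eq : mv d k v = v')
    (ho : ∀ t : ℤ, 0 ≤ t → t ≤ k → ∀ a b, x₀ ≤ a → a ≤ x₁ → y₀ ≤ b → b ≤ y₁ →
      Open n M (mv d t (a + v.1, b + v.2)).1 (mv d t (a + v.1, b + v.2)).2 ∧
      (0 ≤ (mv d t (a + v.1, b + v.2)).1 ∧ (mv d t (a + v.1, b + v.2)).1 ≤ 3 * n) ∧
      0 ≤ (mv d t (a + v.1, b + v.2)).2 ∧ (mv d t (a + v.1, b + v.2)).2 ≤ 3 * n)
    (hw : ∃ c ∈ S, Inb (theBoard n M) (origin n M) (mv d (k + 1) (c + v)) ∧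
      ¬ Open n M (mv d (k + 1) (c + v)).1 (mv d (k + 1) (c + v)).2) :
    ShapeMove n M d S v v' k := by
  refine ⟨eq, ⟨?_, ?_⟩, ?_⟩
  · rintro t ht _ ⟨c, hc, rfl⟩
    obtain ⟨h1, h2, h3, h4⟩ := hS.mem c hc
    exact (ho (t + 1) (by omega) (by omega) c.1 c.2 h1 h2 h3 h4).1.free hn
  · obtain ⟨c, hc, h⟩ := hw
    exact ⟨_, ⟨c, hc, rfl⟩, (blk_iff _).2 h⟩
  · rintro t ht _ ⟨c, hc, rfl⟩
    obtain ⟨h1, h2, h3, h4⟩ := hS.mem c hc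
    exact (ho t (by omega) (by omega) c.1 c.2 h1 h2 h3 h4).2

theorem Bounds.le (hS : Bounds n S x₀ x₁ y₀ y₁) : x₀ ≤ x₁ ∧ y₀ ≤ y₁ := by
  obtain ⟨c, hc, _⟩ := hS.left
  have := hS.mem c hc
  omega

/-- Together with `shape_home_E`, this keeps the shape still while a tile climbs the staircase. -/
theorem shape_home_N (hn : 0 < n) (hS : Bounds n S x₀ x₁ y₀ y₁) :
    ShapeMove n M .N S (2 * n - 1 - x₁, 3 * n - y₁) (2 * n - 1 - x₁, 3 * n - y₁) 0 := by
  have hle := hS.le; have hw := hS.width; have hh := hS.height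
  refine shapeMove_of hn hS (by simp [mv]) ?_ ?_
  · intro t h0 h1 a b ha ha' hb hb'
    simp only [mv, Dir.vec]
    exact ⟨.upper (by omega), by omega⟩
  · obtain ⟨c, hc, hcy⟩ := hS.top
    have := hS.mem c hc
    refine ⟨c, hc, ?_, ?_⟩
    · rw [inb_iff]; simp only [mv, Dir.vec, Prod.fst_add, Prod.snd_add]; omega
    · simp only [mv, Dir.vec, Prod.fst_add, Prod.snd_add]
      intro h; cases h <;> omega

theorem shape_home_E (hn : 0 < n) (hS : Bounds n S x₀ x₁ y₀ y₁) :
    ShapeMove n M .E S (2 * n - 1 - x₁, 3 * n - y₁) (2 * n - 1 - x₁, 3 * n - y₁) 0 := by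
  have hle := hS.le; have hw := hS.width; have hh := hS.height
  refine shapeMove_of hn hS (by simp [mv]) ?_ ?_
  · intro t h0 h1 a b ha ha' hb hb'
    simp only [mv, Dir.vec]
    exact ⟨.upper (by omega), by omega⟩
  · obtain ⟨c, hc, hcy⟩ := hS.right
    have := hS.mem c hc
    refine ⟨c, hc, ?_, ?_⟩
    · rw [inb_iff]; simp only [mv, Dir.vec, Prod.fst_add, Prod.snd_add]; omega
    · simp only [mv, Dir.vec, Prod.fst_add, Prod.snd_add]
      intro h; cases h <;> omega

/-- The floor at height `n` is pierced by the left corridor in the columns below `n`; the shape has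
width at most `n` and is flush with column `2 * n - 1`, so it cannot fall through. -/
theorem shape_home_S (hn : 0 < n) (hS : Bounds n S x₀ x₁ y₀ y₁) {k : ℕ}
    (hk : (k : ℤ) = 2 * n - 1 - y₁ + y₀) :
    ShapeMove n M .S S (2 * n - 1 - x₁, 3 * n - y₁) (2 * n - 1 - x₁, n + 1 - y₀) k := by
  have hle := hS.le; have hw := hS.width; have hh := hS.height
  refine shapeMove_of hn hS ?_ ?_ ?_
  · simp only [mv, Dir.vec, Prod.mk.injEq]; omega
  · intro t h0 h1 a b ha ha' hb hb'
    simp only [mv, Dir.vec]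
    exact ⟨.upper (by omega), by omega⟩
  · obtain ⟨c, hc, hcy⟩ := hS.bottom
    have := hS.mem c hc
    refine ⟨c, hc, ?_, ?_⟩
    · rw [inb_iff]; simp only [mv, Dir.vec, Prod.fst_add, Prod.snd_add]; omega
    · simp only [mv, Dir.vec, Prod.fst_add, Prod.snd_add]
      intro h; cases h <;> omega

theorem shape_middle_E (hn : 0 < n) (hS : Bounds n S x₀ x₁ y₀ y₁) {k : ℕ}
    (hk : (k : ℤ) = n + 1) :
    ShapeMove n M .E S (2 * n - 1 - x₁, n + 1 - y₀) (3 * n - x₁, n + 1 - y₀) k := by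
  have hle := hS.le; have hw := hS.width; have hh := hS.height
  refine shapeMove_of hn hS ?_ ?_ ?_
  · simp only [mv, Dir.vec, Prod.mk.injEq]; omega
  · intro t h0 h1 a b ha ha' hb hb'
    simp only [mv, Dir.vec]
    exact ⟨.jog (by omega), by omega⟩
  · obtain ⟨c, hc, hcy⟩ := hS.right
    have := hS.mem c hc
    refine ⟨c, hc, ?_, ?_⟩
    · rw [inb_iff]; simp only [mv, Dir.vec, Prod.fst_add, Prod.snd_add]; omega
    · simp only [mv, Dir.vec, Prod.fst_add, Prod.snd_add]
      intro h; cases h <;> omega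

theorem shape_right_S (hn : 0 < n) (hS : Bounds n S x₀ x₁ y₀ y₁) {k : ℕ}
    (hk : (k : ℤ) = n + 1) :
    ShapeMove n M .S S (3 * n - x₁, n + 1 - y₀) (3 * n - x₁, -y₀) k := by
  have hle := hS.le; have hw := hS.width; have hh := hS.height
  refine shapeMove_of hn hS ?_ ?_ ?_
  · simp only [mv, Dir.vec, Prod.mk.injEq]; omega
  · intro t h0 h1 a b ha ha' hb hb'
    simp only [mv, Dir.vec]
    exact ⟨.right (by omega), by omega⟩
  · obtain ⟨c, hc, hcy⟩ := hS.bottom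
    have := hS.mem c hc
    refine ⟨c, hc, ?_, ?_⟩
    · rw [inb_iff]; simp only [mv, Dir.vec, Prod.fst_add, Prod.snd_add]; omega
    · simp only [mv, Dir.vec, Prod.fst_add, Prod.snd_add]
      intro h; cases h <;> omega

theorem shape_lower_W (hn : 0 < n) (hS : Bounds n S x₀ x₁ y₀ y₁) {k : ℕ}
    (hk : (k : ℤ) = 3 * n - x₁ + x₀) :
    ShapeMove n M .W S (3 * n - x₁, -y₀) (-x₀, -y₀) k := by
  have hle := hS.le; have hw := hS.width; have hh := hS.height
  refine shapeMove_of hn hS ?_ ?_ ?_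
  · simp only [mv, Dir.vec, Prod.mk.injEq]; omega
  · intro t h0 h1 a b ha ha' hb hb'
    simp only [mv, Dir.vec]
    exact ⟨.lower (by omega), by omega⟩
  · obtain ⟨c, hc, hcy⟩ := hS.left
    have := hS.mem c hc
    refine ⟨c, hc, ?_, ?_⟩
    · rw [inb_iff]; simp only [mv, Dir.vec, Prod.fst_add, Prod.snd_add]; omega
    · simp only [mv, Dir.vec, Prod.fst_add, Prod.snd_add]
      intro h; cases h <;> omega

theorem shape_left_N (hn : 0 < n) (hS : Bounds n S x₀ x₁ y₀ y₁) {k : ℕ}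
    (hk : (k : ℤ) = 3 * n - y₁ + y₀) :
    ShapeMove n M .N S (-x₀, -y₀) (-x₀, 3 * n - y₁) k := by
  have hle := hS.le; have hw := hS.width; have hh := hS.height
  refine shapeMove_of hn hS ?_ ?_ ?_
  · simp only [mv, Dir.vec, Prod.mk.injEq]; omega
  · intro t h0 h1 a b ha ha' hb hb'
    simp only [mv, Dir.vec]
    exact ⟨.left (by omega), by omega⟩
  · obtain ⟨c, hc, hcy⟩ := hS.top
    have := hS.mem c hc
    refine ⟨c, hc, ?_, ?_⟩
    · rw [inb_iff]; simp only [mv, Dir.vec, Prod.fst_add, Prod.snd_add]; omega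
    · simp only [mv, Dir.vec, Prod.fst_add, Prod.snd_add]
      intro h; cases h <;> omega

theorem shape_upper_E (hn : 0 < n) (hS : Bounds n S x₀ x₁ y₀ y₁) {k : ℕ}
    (hk : (k : ℤ) = 2 * n - 1 - x₁ + x₀) :
    ShapeMove n M .E S (-x₀, 3 * n - y₁) (2 * n - 1 - x₁, 3 * n - y₁) k := by
  have hle := hS.le; have hw := hS.width; have hh := hS.height
  refine shapeMove_of hn hS ?_ ?_ ?_
  · simp only [mv, Dir.vec, Prod.mk.injEq]; omega
  · intro t h0 h1 a b ha ha' hb hb'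
    simp only [mv, Dir.vec]
    exact ⟨.upper (by omega), by omega⟩
  · obtain ⟨c, hc, hcy⟩ := hS.right
    have := hS.mem c hc
    refine ⟨c, hc, ?_, ?_⟩
    · rw [inb_iff]; simp only [mv, Dir.vec, Prod.fst_add, Prod.snd_add]; omega
    · simp only [mv, Dir.vec, Prod.fst_add, Prod.snd_add]
      intro h; cases h <;> omega

end shape

end TiltAssembly

namespace TiltAssembly
variable {n M : ℕ} {d : Dir}

/-! ### Motions of the store -/

section store

variable {m : ℕ}

theorem storeMove_of (hn : 0 < n) {X : ℤ} {φ φ' : ℤ × ℤ} {k : ℕ} (eq : mv d k φ = φ')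
    (ho : ∀ j : ℤ, 0 ≤ j → j < m → ∀ t : ℤ, 1 ≤ t → t ≤ k →
      Open n M (mv d t (φ.1 - 4 * j, φ.2)).1 (mv d t (φ.1 - 4 * j, φ.2)).2)
    (hi : ∀ j : ℤ, 0 ≤ j → j < m →
      Inb (theBoard n M) (origin n M) (mv d (k + 1) (φ.1 - 4 * j, φ.2)))
    (hb : ∀ j : ℤ, 0 ≤ j → j < m →
      ¬ Open n M (mv d (k + 1) (φ.1 - 4 * j, φ.2)).1 (mv d (k + 1) (φ.1 - 4 * j, φ.2)).2)
    (hr : ∀ t : ℤ, 0 ≤ t → t ≤ k → (mv d t φ).1 ≤ X ∧ 5 * n + 3 ≤ (mv d t φ).2) :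
    StoreMove n M d m X φ φ' k :=
  ⟨eq, fun j hj => run_singleton hn (ho j (by omega) (by omega)) (hi j (by omega) (by omega))
    (hb j (by omega) (by omega)), fun t ht => hr t (by omega) (by omega)⟩

theorem store_rest_N (hn : 0 < n) (hm : m ≤ M) :
    StoreMove n M .N m (-4) (-4, 5 * n + 5) (-4, 5 * n + 5) 0 := by
  refine storeMove_of hn (by simp [mv]) ?_ ?_ ?_ ?_
  · intro j h0 h1 t ht ht'
    omega
  · intro j h0 h1
    rw [inb_iff]; simp only [mv, Dir.vec]; omega
  · intro j h0 h1 h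
    simp only [mv, Dir.vec] at h
    cases h <;> omega
  · intro t ht ht'
    simp only [mv, Dir.vec]; omega

theorem store_rest_E (hn : 0 < n) (hm : m ≤ M) :
    StoreMove n M .E m (-4) (-4, 5 * n + 5) (-4, 5 * n + 5) 0 := by
  refine storeMove_of hn (by simp [mv]) ?_ ?_ ?_ ?_
  · intro j h0 h1 t ht ht'
    omega
  · intro j h0 h1
    rw [inb_iff]; simp only [mv, Dir.vec]; omega
  · intro j h0 h1 h
    simp only [mv, Dir.vec] at h
    cases h <;> omega
  · intro t ht ht'
    simp only [mv, Dir.vec]; omega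

/-- This starts the zigzag S, E, S, W, N, E, whose total displacement is one period `(4, 0)`. The
suffix of each name in this family is the word executed so far, and periodicity makes all stored
tiles stop simultaneously. -/
theorem store_S (hn : 0 < n) (hm : m ≤ M) :
    StoreMove n M .S m 0 (-4, 5 * n + 5) (-4, 5 * n + 4) 1 := by
  refine storeMove_of hn (by simp only [mv, Dir.vec, Prod.mk.injEq]; omega) ?_ ?_ ?_ ?_
  · intro j h0 h1 t ht ht'
    simp only [mv, Dir.vec]
    exact .store (by omega)
  · intro j h0 h1
    rw [inb_iff]; simp only [mv, Dir.vec]; omega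
  · intro j h0 h1 h
    simp only [mv, Dir.vec] at h
    cases h <;> omega
  · intro t ht ht'
    simp only [mv, Dir.vec]; omega

theorem store_SE (hn : 0 < n) (hm : m ≤ M) :
    StoreMove n M .E m 0 (-4, 5 * n + 4) (-2, 5 * n + 4) 2 := by
  refine storeMove_of hn (by simp only [mv, Dir.vec, Prod.mk.injEq]; omega) ?_ ?_ ?_ ?_
  · intro j h0 h1 t ht ht'
    simp only [mv, Dir.vec]
    exact .store (by omega)
  · intro j h0 h1
    rw [inb_iff]; simp only [mv, Dir.vec]; omega
  · intro j h0 h1 h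
    simp only [mv, Dir.vec] at h
    cases h <;> omega
  · intro t ht ht'
    simp only [mv, Dir.vec]; omega

theorem store_SES (hn : 0 < n) (hm : m ≤ M) :
    StoreMove n M .S m 0 (-2, 5 * n + 4) (-2, 5 * n + 3) 1 := by
  refine storeMove_of hn (by simp only [mv, Dir.vec, Prod.mk.injEq]; omega) ?_ ?_ ?_ ?_
  · intro j h0 h1 t ht ht'
    simp only [mv, Dir.vec]
    exact .store (by omega)
  · intro j h0 h1
    rw [inb_iff]; simp only [mv, Dir.vec]; omega
  · intro j h0 h1 h
    simp only [mv, Dir.vec] at h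
    cases h <;> omega
  · intro t ht ht'
    simp only [mv, Dir.vec]; omega

/-- The preceding S put the tiles into dead ends, so W cannot undo the eastward progress. -/
theorem store_SESW (hn : 0 < n) (hm : m ≤ M) :
    StoreMove n M .W m 0 (-2, 5 * n + 3) (-2, 5 * n + 3) 0 := by
  refine storeMove_of hn (by simp [mv]) ?_ ?_ ?_ ?_
  · intro j h0 h1 t ht ht'
    omega
  · intro j h0 h1
    rw [inb_iff]; simp only [mv, Dir.vec]; omega
  · intro j h0 h1 h
    simp only [mv, Dir.vec] at h
    cases h <;> omega
  · intro t ht ht'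
    simp only [mv, Dir.vec]; omega

theorem store_SESWN (hn : 0 < n) (hm : m ≤ M) :
    StoreMove n M .N m 0 (-2, 5 * n + 3) (-2, 5 * n + 5) 2 := by
  refine storeMove_of hn (by simp only [mv, Dir.vec, Prod.mk.injEq]; omega) ?_ ?_ ?_ ?_
  · intro j h0 h1 t ht ht'
    simp only [mv, Dir.vec]
    exact .store (by omega)
  · intro j h0 h1
    rw [inb_iff]; simp only [mv, Dir.vec]; omega
  · intro j h0 h1 h
    simp only [mv, Dir.vec] at h
    cases h <;> omega
  · intro t ht ht'
    simp only [mv, Dir.vec]; omega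

theorem store_SESWNE (hn : 0 < n) (hm : m ≤ M) :
    StoreMove n M .E m 0 (-2, 5 * n + 5) (0, 5 * n + 5) 2 := by
  refine storeMove_of hn (by simp only [mv, Dir.vec, Prod.mk.injEq]; omega) ?_ ?_ ?_ ?_
  · intro j h0 h1 t ht ht'
    simp only [mv, Dir.vec]
    -- Only the front tile leaves the reservoir: its last cell is the foot of the staircase.
    rcases (show -2 - 4 * j + t * 1 = 0 ∨ -2 - 4 * j + t * 1 ≤ -1 by omega) with h | h
    · exact .climb (by omega)
    · exact .store (by omega)
  · intro j h0 h1
    rw [inb_iff]; simp only [mv, Dir.vec]; omega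
  · intro j h0 h1 h
    simp only [mv, Dir.vec] at h
    cases h <;> omega
  · intro t ht ht'
    simp only [mv, Dir.vec]; omega

end store

/-! ### Motions of the tile -/

theorem tileMove_of (hn : 0 < n) {X : ℤ} {q q' : ℤ × ℤ} {k : ℕ} (eq : mv d k q = q')
    (ho : ∀ t : ℤ, 1 ≤ t → t ≤ k → Open n M (mv d t q).1 (mv d t q).2)
    (hi : Inb (theBoard n M) (origin n M) (mv d (k + 1) q))
    (hb : ¬ Open n M (mv d (k + 1) q).1 (mv d (k + 1) q).2)
    (hc : ∀ t : ℤ, 0 ≤ t → t ≤ k → (X + 2 ≤ (mv d t q).1 ∨ (mv d t q).2 ≤ 4 * n + 1) ∧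
      (3 * n + 2 ≤ (mv d t q).1 ∨ (mv d t q).1 ≤ -2 ∨ 3 * n + 2 ≤ (mv d t q).2 ∨
        (mv d t q).2 ≤ -2)) :
    TileMove n M d X q q' k :=
  ⟨eq, run_singleton hn ho hi hb, fun t ht => (hc t (by omega) (by omega)).1,
    fun t ht => (hc t (by omega) (by omega)).2⟩

theorem climb_N (hn : 0 < n) {r : ℤ} (h0 : 0 ≤ r) (hr : r ≤ 5 * n) :
    TileMove n M .N (-4) (2 * r, 5 * n + 5 + r) (2 * r, 5 * n + 6 + r) 1 := by
  refine tileMove_of hn ?_ ?_ ?_ ?_ ?_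
  · simp only [mv, Dir.vec, Prod.mk.injEq]; omega
  · intro t ht ht'
    simp only [mv, Dir.vec]
    exact .climb (by omega)
  · rw [inb_iff]; simp only [mv, Dir.vec]; omega
  · intro h
    simp only [mv, Dir.vec] at h
    cases h <;> omega
  · intro t ht ht'
    simp only [mv, Dir.vec]; omega

theorem climb_E (hn : 0 < n) {r : ℤ} (h0 : 0 ≤ r) (hr : r ≤ 5 * n) :
    TileMove n M .E (-4) (2 * r, 5 * n + 6 + r) (2 * (r + 1), 5 * n + 5 + (r + 1)) 2 := by
  refine tileMove_of hn ?_ ?_ ?_ ?_ ?_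
  · simp only [mv, Dir.vec, Prod.mk.injEq]; omega
  · intro t ht ht'
    simp only [mv, Dir.vec]
    exact .climb (by omega)
  · rw [inb_iff]; simp only [mv, Dir.vec]; omega
  · intro h
    simp only [mv, Dir.vec] at h
    cases h <;> omega
  · intro t ht ht'
    simp only [mv, Dir.vec]; omega

/-- Each shaft ends on a different row of the wedge; the diagonal edge of the lane then turns that
row into the column `2 * n + r` in `tileN_SE`. -/
theorem tileN_S (hn : 0 < n) {r : ℤ} (h0 : 1 ≤ r) (hr : r ≤ n) {k : ℕ}
    (hk : (k : ℤ) = n + 3 + 2 * r) :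
    TileMove n M .S 0 (2 * r, 5 * n + 5 + r) (2 * r, 4 * n + 2 - r) k := by
  refine tileMove_of hn ?_ ?_ ?_ ?_ ?_
  · simp only [mv, Dir.vec, Prod.mk.injEq]; omega
  · intro t ht ht'
    simp only [mv, Dir.vec]
    rcases le_or_gt (4 * n + 2 : ℤ) (5 * n + 5 + r + t * -1) with h | h
    · exact .shaftN (by omega)
    · exact .wedgeN (by omega)
  · rw [inb_iff]; simp only [mv, Dir.vec]; omega
  · intro h
    simp only [mv, Dir.vec] at h
    cases h <;> omega
  · intro t ht ht'
    simp only [mv, Dir.vec]; omega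

theorem tileN_SE (hn : 0 < n) {r : ℤ} (h0 : 1 ≤ r) (hr : r ≤ n) {k : ℕ}
    (hk : (k : ℤ) = 2 * n - r) :
    TileMove n M .E 0 (2 * r, 4 * n + 2 - r) (2 * n + r, 4 * n + 2 - r) k := by
  refine tileMove_of hn ?_ ?_ ?_ ?_ ?_
  · simp only [mv, Dir.vec, Prod.mk.injEq]; omega
  · intro t ht ht'
    simp only [mv, Dir.vec]
    rcases le_or_gt (2 * r + t * 1) (2 * n : ℤ) with h | h
    · exact .wedgeN (by omega)
    · exact .laneN (by omega)
  · rw [inb_iff]; simp only [mv, Dir.vec]; omega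
  · intro h
    simp only [mv, Dir.vec] at h
    cases h <;> omega
  · intro t ht ht'
    simp only [mv, Dir.vec]; omega

/-- The sloping lower right edge of the field selects row `j` and also blocks E and S, so the tile
waits there while the shape makes its next two moves. -/
theorem tileE_S (hn : 0 < n) {j : ℤ} (h0 : 0 ≤ j) (hj : j ≤ n - 1) {k : ℕ}
    (hk : (k : ℤ) = 7 * n + 6) :
    TileMove n M .S 0 (2 * (2 * n + 1 + j), 5 * n + 5 + (2 * n + 1 + j))
      (2 * (2 * n + 1 + j), j) k := by
  refine tileMove_of hn ?_ ?_ ?_ ?_ ?_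
  · simp only [mv, Dir.vec, Prod.mk.injEq]; omega
  · intro t ht ht'
    simp only [mv, Dir.vec]
    exact .shaftE (by omega)
  · rw [inb_iff]; simp only [mv, Dir.vec]; omega
  · intro h
    simp only [mv, Dir.vec] at h
    cases h <;> omega
  · intro t ht ht'
    simp only [mv, Dir.vec]; omega

theorem tileE_rest_E (hn : 0 < n) {j : ℤ} (h0 : 0 ≤ j) (hj : j ≤ n - 1) :
    TileMove n M .E 0 (2 * (2 * n + 1 + j), j) (2 * (2 * n + 1 + j), j) 0 := by
  refine tileMove_of hn (by simp [mv]) ?_ ?_ ?_ ?_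
  · intro t ht ht'
    omega
  · rw [inb_iff]; simp only [mv, Dir.vec]; omega
  · intro h
    simp only [mv, Dir.vec] at h
    cases h <;> omega
  · intro t ht ht'
    simp only [mv, Dir.vec]; omega

theorem tileE_rest_S (hn : 0 < n) {j : ℤ} (h0 : 0 ≤ j) (hj : j ≤ n - 1) :
    TileMove n M .S 0 (2 * (2 * n + 1 + j), j) (2 * (2 * n + 1 + j), j) 0 := by
  refine tileMove_of hn (by simp [mv]) ?_ ?_ ?_ ?_
  · intro t ht ht'
    omega
  · rw [inb_iff]; simp only [mv, Dir.vec]; omega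
  · intro h
    simp only [mv, Dir.vec] at h
    cases h <;> omega
  · intro t ht ht'
    simp only [mv, Dir.vec]; omega

theorem tileS_S (hn : 0 < n) {j : ℤ} (h0 : 0 ≤ j) (hj : j ≤ n - 1) {k : ℕ}
    (hk : (k : ℤ) = 9 * n + 7) :
    TileMove n M .S 0 (2 * (3 * n + 1 + j), 5 * n + 5 + (3 * n + 1 + j))
      (2 * (3 * n + 1 + j), -n - 1 + j) k := by
  refine tileMove_of hn ?_ ?_ ?_ ?_ ?_
  · simp only [mv, Dir.vec, Prod.mk.injEq]; omega
  · intro t ht ht'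
    simp only [mv, Dir.vec]
    exact .shaftS (by omega)
  · rw [inb_iff]; simp only [mv, Dir.vec]; omega
  · intro h
    simp only [mv, Dir.vec] at h
    cases h <;> omega
  · intro t ht ht'
    simp only [mv, Dir.vec]; omega

theorem tileS_rest_E (hn : 0 < n) {j : ℤ} (h0 : 0 ≤ j) (hj : j ≤ n - 1) :
    TileMove n M .E 0 (2 * (3 * n + 1 + j), -n - 1 + j) (2 * (3 * n + 1 + j), -n - 1 + j) 0 := by
  refine tileMove_of hn (by simp [mv]) ?_ ?_ ?_ ?_
  · intro t ht ht'
    omega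
  · rw [inb_iff]; simp only [mv, Dir.vec]; omega
  · intro h
    simp only [mv, Dir.vec] at h
    cases h <;> omega
  · intro t ht ht'
    simp only [mv, Dir.vec]; omega

theorem tileS_rest_S (hn : 0 < n) {j : ℤ} (h0 : 0 ≤ j) (hj : j ≤ n - 1) :
    TileMove n M .S 0 (2 * (3 * n + 1 + j), -n - 1 + j) (2 * (3 * n + 1 + j), -n - 1 + j) 0 := by
  refine tileMove_of hn (by simp [mv]) ?_ ?_ ?_ ?_
  · intro t ht ht'
    omega
  · rw [inb_iff]; simp only [mv, Dir.vec]; omega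
  · intro h
    simp only [mv, Dir.vec] at h
    cases h <;> omega
  · intro t ht ht'
    simp only [mv, Dir.vec]; omega

/-- The diagonal edge of `laneS` converts the row of the tile into a column under the left corridor,
ready for the following N. -/
theorem tileS_W (hn : 0 < n) {j : ℤ} (h0 : 0 ≤ j) (hj : j ≤ n - 1) {k : ℕ}
    (hk : (k : ℤ) = 5 * n + 3 + 3 * j) :
    TileMove n M .W 0 (2 * (3 * n + 1 + j), -n - 1 + j) (n - 1 - j, -n - 1 + j) k := by
  refine tileMove_of hn ?_ ?_ ?_ ?_ ?_
  · simp only [mv, Dir.vec, Prod.mk.injEq]; omega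
  · intro t ht ht'
    simp only [mv, Dir.vec]
    rcases le_or_gt (n : ℤ) (2 * (3 * n + 1 + j) + t * -1) with h | h
    · exact .fieldS (by omega)
    · exact .laneS (by omega)
  · rw [inb_iff]; simp only [mv, Dir.vec]; omega
  · intro h
    simp only [mv, Dir.vec] at h
    cases h <;> omega
  · intro t ht ht'
    simp only [mv, Dir.vec]; omega

theorem tileW_S (hn : 0 < n) {j : ℤ} (h0 : 0 ≤ j) (hj : j ≤ n - 1) {k : ℕ}
    (hk : (k : ℤ) = 11 * n + 8) :
    TileMove n M .S 0 (2 * (4 * n + 1 + j), 5 * n + 5 + (4 * n + 1 + j))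
      (2 * (4 * n + 1 + j), -2 * n - 2 + j) k := by
  refine tileMove_of hn ?_ ?_ ?_ ?_ ?_
  · simp only [mv, Dir.vec, Prod.mk.injEq]; omega
  · intro t ht ht'
    simp only [mv, Dir.vec]
    exact .shaftW (by omega)
  · rw [inb_iff]; simp only [mv, Dir.vec]; omega
  · intro h
    simp only [mv, Dir.vec] at h
    cases h <;> omega
  · intro t ht ht'
    simp only [mv, Dir.vec]; omega

theorem tileW_rest_E (hn : 0 < n) {j : ℤ} (h0 : 0 ≤ j) (hj : j ≤ n - 1) :
    TileMove n M .E 0 (2 * (4 * n + 1 + j), -2 * n - 2 + j)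
      (2 * (4 * n + 1 + j), -2 * n - 2 + j) 0 := by
  refine tileMove_of hn (by simp [mv]) ?_ ?_ ?_ ?_
  · intro t ht ht'
    omega
  · rw [inb_iff]; simp only [mv, Dir.vec]; omega
  · intro h
    simp only [mv, Dir.vec] at h
    cases h <;> omega
  · intro t ht ht'
    simp only [mv, Dir.vec]; omega

theorem tileW_rest_S (hn : 0 < n) {j : ℤ} (h0 : 0 ≤ j) (hj : j ≤ n - 1) :
    TileMove n M .S 0 (2 * (4 * n + 1 + j), -2 * n - 2 + j)
      (2 * (4 * n + 1 + j), -2 * n - 2 + j) 0 := by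
  refine tileMove_of hn (by simp [mv]) ?_ ?_ ?_ ?_
  · intro t ht ht'
    omega
  · rw [inb_iff]; simp only [mv, Dir.vec]; omega
  · intro h
    simp only [mv, Dir.vec] at h
    cases h <;> omega
  · intro t ht ht'
    simp only [mv, Dir.vec]; omega

/-- Two diagonals are needed here: this one selects a column of the western lane, and the upper one
used in `tileW_WN` turns it into the row `3 * n - j` of the upper room. -/
theorem tileW_W (hn : 0 < n) {j : ℤ} (h0 : 0 ≤ j) (hj : j ≤ n - 1) {k : ℕ}
    (hk : (k : ℤ) = 8 * n + 4 + 3 * j) :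
    TileMove n M .W 0 (2 * (4 * n + 1 + j), -2 * n - 2 + j) (-2 - j, -2 * n - 2 + j) k := by
  refine tileMove_of hn ?_ ?_ ?_ ?_ ?_
  · simp only [mv, Dir.vec, Prod.mk.injEq]; omega
  · intro t ht ht'
    simp only [mv, Dir.vec]
    rcases le_or_gt (-1 : ℤ) (2 * (4 * n + 1 + j) + t * -1) with h | h
    · exact .fieldW (by omega)
    · exact .laneW (by omega)
  · rw [inb_iff]; simp only [mv, Dir.vec]; omega
  · intro h
    simp only [mv, Dir.vec] at h
    cases h <;> omega
  · intro t ht ht'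
    simp only [mv, Dir.vec]; omega

theorem tileW_WN (hn : 0 < n) {j : ℤ} (h0 : 0 ≤ j) (hj : j ≤ n - 1) {k : ℕ}
    (hk : (k : ℤ) = 5 * n + 2 - 2 * j) :
    TileMove n M .N 0 (-2 - j, -2 * n - 2 + j) (-2 - j, 3 * n - j) k := by
  refine tileMove_of hn ?_ ?_ ?_ ?_ ?_
  · simp only [mv, Dir.vec, Prod.mk.injEq]; omega
  · intro t ht ht'
    simp only [mv, Dir.vec]
    exact .laneW (by omega)
  · rw [inb_iff]; simp only [mv, Dir.vec]; omega
  · intro h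
    simp only [mv, Dir.vec] at h
    cases h <;> omega
  · intro t ht ht'
    simp only [mv, Dir.vec]; omega

end TiltAssembly

namespace TiltAssembly
variable {n M : ℕ} {d : Dir}

/-! ### Sequences of tilts -/

/-- At most `l` tilts turn `C` into `C'`. -/
def Reach (l : ℕ) (C C' : Config (Fin 1)) : Prop :=
  ∃ ds : List Dir, ds.length ≤ l ∧ TiltSeq selfAff ds C C'

theorem TiltSeq.append {ds ds' : List Dir} {C C' C'' : Config (Fin 1)}
    (h : TiltSeq selfAff ds C C') (h' : TiltSeq selfAff ds' C' C'') :
    TiltSeq selfAff (ds ++ ds') C C'' := by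
  induction ds generalizing C with
  | nil => obtain rfl : C = C' := h; exact h'
  | cons d ds ih =>
    obtain ⟨C₁, h1, h2⟩ := h
    exact ⟨C₁, h1, ih h2⟩

theorem TiltSeq.reconfigurable {ds : List Dir} (hds : ds ≠ []) {C C' : Config (Fin 1)}
    (h : TiltSeq selfAff ds C C') : Reconfigurable selfAff C C' := by
  induction ds generalizing C with
  | nil => exact absurd rfl hds
  | cons d ds ih =>
    obtain ⟨C₁, h1, h2⟩ := h
    by_cases hd : ds = []
    · subst hd
      obtain rfl : C₁ = C' := h2
      exact .single ⟨d, h1⟩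
    · exact .head ⟨d, h1⟩ (ih hd h2)

theorem Reach.refl (C : Config (Fin 1)) : Reach 0 C C := ⟨[], le_rfl, rfl⟩

theorem Reach.trans {l l' : ℕ} {C C' C'' : Config (Fin 1)} (h : Reach l C C')
    (h' : Reach l' C' C'') : Reach (l + l') C C'' := by
  obtain ⟨ds, hl, hs⟩ := h
  obtain ⟨ds', hl', hs'⟩ := h'
  exact ⟨ds ++ ds', by rw [List.length_append]; omega, hs.append hs'⟩

theorem Reach.mono {l l' : ℕ} {C C' : Config (Fin 1)} (h : Reach l C C') (hl : l ≤ l') :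
    Reach l' C C' := by
  obtain ⟨ds, h1, h2⟩ := h
  exact ⟨ds, h1.trans hl, h2⟩

theorem Tilt.reach {C C' : Config (Fin 1)} (h : Tilt selfAff d C C') : Reach 1 C C' :=
  ⟨[d], le_rfl, C', h, rfl⟩

/-! ### Processing one tile -/

section word

variable {S : Set (ℤ × ℤ)} {x₀ x₁ y₀ y₁ : ℤ} {m : ℕ}

/-- The configuration with `S` in its home position and `m` tiles in the reservoir. -/
def home (n M : ℕ) (S : Set (ℤ × ℤ)) (x₁ y₁ : ℤ) (m : ℕ) : Config (Fin 1) :=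
  noTile (theBoard n M) (origin n M) (place S (2 * n - 1 - x₁, 3 * n - y₁)) (0, 5 * n + 5) m

/-- The configuration with `S` in its home position, a tile on the `r`-th step of the staircase
and `m` tiles in the reservoir. -/
def climbing (n M : ℕ) (S : Set (ℤ × ℤ)) (x₁ y₁ : ℤ) (m : ℕ) (r : ℤ) : Config (Fin 1) :=
  withTile (theBoard n M) (origin n M) (place S (2 * n - 1 - x₁, 3 * n - y₁))
    (2 * r, 5 * n + 5 + r) (-4, 5 * n + 5) m

/-- The same configuration is read in two ways: the front tile of the reservoir stands at the foot
of the staircase, so it may be renamed as the travelling tile. -/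
theorem home_succ (S : Set (ℤ × ℤ)) (x₁ y₁ : ℤ) (m : ℕ) :
    home n M S x₁ y₁ (m + 1) = climbing n M S x₁ y₁ m 0 := by
  rw [home, climbing, noTile, withTile]
  congr 1
  ext X
  constructor
  · rintro ⟨_ | _ | _ | i, ⟨hi, hi'⟩, rfl⟩
    · exact ⟨0, by simp, rfl⟩
    · exact absurd rfl hi'
    · exact ⟨1, by simp, by simp [pieces, stored]⟩
    · refine ⟨i + 2, ?_, ?_⟩
      · rw [Set.mem_ofPred_eq]; omega
      · simp only [pieces, stored]
        congr 2
        push_cast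
        ring
  · rintro ⟨_ | _ | i, hi, rfl⟩
    · exact ⟨0, by simp, rfl⟩
    · exact ⟨2, by simp, by simp [pieces, stored]⟩
    · rw [Set.mem_ofPred_eq] at hi
      refine ⟨i + 3, ⟨by omega, by omega⟩, ?_⟩
      simp only [pieces, stored]
      congr 2
      push_cast
      ring

theorem reach_climbing (hn : 0 < n) (hS : Bounds n S x₀ x₁ y₀ y₁) (hm : m ≤ M) (r : ℕ)
    (hr : r ≤ 5 * n + 1) : Reach (2 * r) (home n M S x₁ y₁ (m + 1)) (climbing n M S x₁ y₁ m r) := by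
  induction r with
  | zero => rw [home_succ]; exact Reach.refl _
  | succ r ih =>
    have h1 := (climb_N hn (by omega : (0 : ℤ) ≤ r) (by omega)).tilt
      (shape_home_N hn hS) (store_rest_N (M := M) hn hm)
    have h2 := (climb_E hn (by omega : (0 : ℤ) ≤ r) (by omega)).tilt
      (shape_home_E hn hS) (store_rest_E (M := M) hn hm)
    exact ((ih (by omega)).trans (h1.reach.trans h2.reach)).mono (by omega)

theorem reach_home_of_upper (hn : 0 < n) (hS : Bounds n S x₀ x₁ y₀ y₁) (hm : m ≤ M) :
    Reach 1 (noTile (theBoard n M) (origin n M) (place S (-x₀, 3 * n - y₁)) (-2, 5 * n + 5) m)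
      (home n M S x₁ y₁ m) := by
  have hw := hS.width
  obtain ⟨k, hk⟩ := exists_natCast (show 0 ≤ 2 * n - 1 - x₁ + x₀ by omega)
  exact ((shape_upper_E hn hS hk).tilt (store_SESWNE hn hm)).reach

theorem reach_home_of_left (hn : 0 < n) (hS : Bounds n S x₀ x₁ y₀ y₁) (hm : m ≤ M) :
    Reach 2 (noTile (theBoard n M) (origin n M) (place S (-x₀, -y₀)) (-2, 5 * n + 3) m)
      (home n M S x₁ y₁ m) := by
  have hh := hS.height
  obtain ⟨k, hk⟩ := exists_natCast (show 0 ≤ 3 * n - y₁ + y₀ by omega)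
  exact ((shape_left_N hn hS hk).tilt (store_SESWN hn hm)).reach.trans
    (reach_home_of_upper hn hS hm)

theorem reach_home_of_lower (hn : 0 < n) (hS : Bounds n S x₀ x₁ y₀ y₁) (hm : m ≤ M) :
    Reach 3 (noTile (theBoard n M) (origin n M) (place S (3 * n - x₁, -y₀)) (-2, 5 * n + 3) m)
      (home n M S x₁ y₁ m) := by
  have hw := hS.width
  obtain ⟨k, hk⟩ := exists_natCast (show 0 ≤ 3 * n - x₁ + x₀ by omega)
  exact ((shape_lower_W hn hS hk).tilt (store_SESW hn hm)).reach.trans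
    (reach_home_of_left hn hS hm)

theorem reach_home_of_right (hn : 0 < n) (hS : Bounds n S x₀ x₁ y₀ y₁) (hm : m ≤ M) :
    Reach 4 (noTile (theBoard n M) (origin n M) (place S (3 * n - x₁, n + 1 - y₀))
      (-2, 5 * n + 4) m) (home n M S x₁ y₁ m) := by
  obtain ⟨k, hk⟩ := exists_natCast (show 0 ≤ (n : ℤ) + 1 by omega)
  exact ((shape_right_S hn hS hk).tilt (store_SES hn hm)).reach.trans
    (reach_home_of_lower hn hS hm)

theorem reach_home_of_middle (hn : 0 < n) (hS : Bounds n S x₀ x₁ y₀ y₁) (hm : m ≤ M) :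
    Reach 5 (noTile (theBoard n M) (origin n M) (place S (2 * n - 1 - x₁, n + 1 - y₀))
      (-4, 5 * n + 4) m) (home n M S x₁ y₁ m) := by
  obtain ⟨k, hk⟩ := exists_natCast (show 0 ≤ (n : ℤ) + 1 by omega)
  exact ((shape_middle_E hn hS hk).tilt (store_SE hn hm)).reach.trans
    (reach_home_of_right hn hS hm)

/-- Climbing past all other shafts costs `10 * n + 2` tilts. The fall of `12 * n + 9` units ends on
the bottom row of the board, and the next unit removes the tile; five tilts complete the cycle. -/
theorem reach_discard (hn : 0 < n) (hS : Bounds n S x₀ x₁ y₀ y₁) (hm : m ≤ M) :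
    Reach (10 * n + 8) (home n M S x₁ y₁ (m + 1)) (home n M S x₁ y₁ m) := by
  have hw := hS.width; have hh := hS.height
  obtain ⟨k, hk⟩ := exists_natCast (show 0 ≤ 2 * n - 1 - y₁ + y₀ by omega)
  have h1 := exit_tilt (k₁ := 12 * n + 9) (q := (2 * (5 * n + 1), 5 * n + 5 + (5 * n + 1)))
    (shape_home_S (M := M) hn hS hk) (store_S hn hm) ?_ ?_ ?_ ?_
  · have h0 := reach_climbing (M := M) hn hS hm (5 * n + 1) le_rfl
    rw [climbing] at h0
    push_cast at h0
    exact (h0.trans (h1.reach.trans (reach_home_of_middle hn hS hm))).mono (by omega)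
  · refine free_singleton hn fun t ht ht' => ?_
    simp only [mv, Dir.vec]
    push_cast at ht'
    exact .shaftOut (by omega)
  · intro t ht
    simp only [mv, Dir.vec]; omega
  · intro t ht
    simp only [mv, Dir.vec]; omega
  · rw [inb_iff]
    simp only [mv, Dir.vec]
    push_cast
    omega

/-! ### Attaching a tile from each of the four directions. -/

variable {p : ℤ × ℤ} {x₀' x₁' y₀' y₁' : ℤ}

/-- At impact the shape rests against the right wall and the floor. The new tile changes neither its
right nor its bottom bound, so the enlarged shape is correctly placed for the rest of the circuit;
the other directions work likewise with their own two walls. -/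
theorem reach_drop_N (hn : 0 < n) (hS : Bounds n S x₀ x₁ y₀ y₁)
    (hS' : Bounds n (insert p S) x₀' x₁ y₀ y₁') (hp : CanDrop S .N p)
    (hx : x₀ ≤ p.1 ∧ p.1 ≤ x₁) (hy : y₀ ≤ p.2 ∧ p.2 ≤ y₁ + 1) (hm : m ≤ M) :
    Reach (10 * n + 8) (home n M S x₁ y₁ (m + 1)) (home n M (insert p S) x₁ y₁' m) := by
  have hw := hS.width; have hh := hS.height
  -- With the shape flush right at column `3 * n`, the point `p` is in column `2 * n + r`.
  obtain ⟨r, hr⟩ := exists_natCast (show 0 ≤ n - x₁ + p.1 by omega)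
  obtain ⟨a, ha⟩ := exists_natCast (show 0 ≤ 2 * n - 1 - y₁ + y₀ by omega)
  obtain ⟨b, hb⟩ := exists_natCast (show 0 ≤ (n : ℤ) + 1 by omega)
  obtain ⟨k, hk⟩ := exists_natCast (show 0 ≤ (n : ℤ) + 3 + 2 * r by omega)
  obtain ⟨k', hk'⟩ := exists_natCast (show 0 ≤ 2 * (n : ℤ) - r by omega)
  obtain ⟨l, hl⟩ := exists_natCast (show 0 ≤ 4 * n + 2 - r - p.2 + y₀ by omega)
  have h1 := (tileN_S (M := M) hn (r := r) (by omega) (by omega) hk).tilt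
    (shape_home_S hn hS ha) (store_S hn hm)
  have h2 := (tileN_SE (M := M) hn (r := r) (by omega) (by omega) hk').tilt
    (shape_middle_E hn hS hb) (store_SE hn hm)
  have h3 := drop_tilt (k₁ := l) (q := (2 * n + r, 4 * n + 2 - r)) (shape_right_S (M := M) hn hS hb)
    (store_SES hn hm) (e := .N) (by simp [Dir.vec]) hp ?_ (by omega) ?_ ?_
  · exact ((reach_climbing hn hS hm r (by omega)).trans (h1.reach.trans (h2.reach.trans
      (h3.reach.trans (reach_home_of_lower hn hS' hm))))).mono (by omega)
  · ext <;> simp only [mv, Dir.vec, Prod.fst_add, Prod.snd_add] <;> omega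
  · refine free_singleton hn fun t ht ht' => ?_
    simp only [mv, Dir.vec]
    rcases le_or_gt (2 * n + 1 : ℤ) (4 * n + 2 - r + t * -1) with h | h
    · exact .laneN (by omega)
    · exact .right (by omega)
  · intro t ht
    simp only [mv, Dir.vec]; omega

theorem reach_drop_E (hn : 0 < n) (hS : Bounds n S x₀ x₁ y₀ y₁)
    (hS' : Bounds n (insert p S) x₀ x₁' y₀ y₁') (hp : CanDrop S .E p)
    (hx : x₀ ≤ p.1 ∧ p.1 ≤ x₁ + 1) (hy : y₀ ≤ p.2 ∧ p.2 ≤ y₁) (hm : m ≤ M) :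
    Reach (10 * n + 8) (home n M S x₁ y₁ (m + 1)) (home n M (insert p S) x₁' y₁' m) := by
  have hw := hS.width; have hh := hS.height
  -- The bottom of the shape lies on row `0` during the tilt W, so this is the row of `p`.
  obtain ⟨j, hj⟩ := exists_natCast (show 0 ≤ p.2 - y₀ by omega)
  obtain ⟨a, ha⟩ := exists_natCast (show 0 ≤ 2 * n - 1 - y₁ + y₀ by omega)
  obtain ⟨b, hb⟩ := exists_natCast (show 0 ≤ (n : ℤ) + 1 by omega)
  obtain ⟨c, hc⟩ := exists_natCast (show 0 ≤ 3 * n - x₁ + x₀ by omega)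
  obtain ⟨k, hk⟩ := exists_natCast (show 0 ≤ 7 * (n : ℤ) + 6 by omega)
  obtain ⟨l, hl⟩ := exists_natCast (show 0 ≤ 2 * (2 * n + 1 + j) - p.1 + x₀ by omega)
  have h1 := (tileE_S (M := M) hn (j := j) (by omega) (by omega) hk).tilt
    (shape_home_S hn hS ha) (store_S hn hm)
  have h2 := (tileE_rest_E (M := M) hn (j := j) (by omega) (by omega)).tilt
    (shape_middle_E hn hS hb) (store_SE hn hm)
  have h3 := (tileE_rest_S (M := M) hn (j := j) (by omega) (by omega)).tilt
    (shape_right_S hn hS hb) (store_SES hn hm)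
  have h4 := drop_tilt (k₁ := l) (q := (2 * (2 * n + 1 + j), j)) (shape_lower_W (M := M) hn hS hc)
    (store_SESW hn hm) (e := .E) (by simp [Dir.vec]) hp ?_ (by omega) ?_ ?_
  · have h0 := reach_climbing (M := M) hn hS hm (2 * n + 1 + j) (by omega)
    rw [climbing] at h0
    push_cast at h0
    exact (h0.trans (h1.reach.trans (h2.reach.trans
      (h3.reach.trans (h4.reach.trans (reach_home_of_left hn hS' hm)))))).mono (by omega)
  · ext <;> simp only [mv, Dir.vec, Prod.fst_add, Prod.snd_add] <;> omega
  · refine free_singleton hn fun t ht ht' => ?_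
    simp only [mv, Dir.vec]
    rcases le_or_gt (3 * n + 1 : ℤ) (2 * (2 * n + 1 + j) + t * -1) with h | h
    · exact .fieldE (by omega)
    · exact .lower (by omega)
  · intro t ht
    simp only [mv, Dir.vec]; omega

theorem reach_drop_S (hn : 0 < n) (hS : Bounds n S x₀ x₁ y₀ y₁)
    (hS' : Bounds n (insert p S) x₀ x₁' y₀' y₁) (hp : CanDrop S .S p)
    (hx : x₀ ≤ p.1 ∧ p.1 ≤ x₁) (hy : y₀ - 1 ≤ p.2 ∧ p.2 ≤ y₁) (hm : m ≤ M) :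
    Reach (10 * n + 8) (home n M S x₁ y₁ (m + 1)) (home n M (insert p S) x₁' y₁ m) := by
  have hw := hS.width; have hh := hS.height
  -- The shape is flush left at column `0`, and the lane delivers to column `n - 1 - j`.
  obtain ⟨j, hj⟩ := exists_natCast (show 0 ≤ n - 1 - p.1 + x₀ by omega)
  obtain ⟨a, ha⟩ := exists_natCast (show 0 ≤ 2 * n - 1 - y₁ + y₀ by omega)
  obtain ⟨b, hb⟩ := exists_natCast (show 0 ≤ (n : ℤ) + 1 by omega)
  obtain ⟨c, hc⟩ := exists_natCast (show 0 ≤ 3 * n - x₁ + x₀ by omega)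
  obtain ⟨e, he⟩ := exists_natCast (show 0 ≤ 3 * n - y₁ + y₀ by omega)
  obtain ⟨k, hk⟩ := exists_natCast (show 0 ≤ 9 * (n : ℤ) + 7 by omega)
  obtain ⟨k', hk'⟩ := exists_natCast (show 0 ≤ 5 * (n : ℤ) + 3 + 3 * j by omega)
  obtain ⟨l, hl⟩ := exists_natCast (show 0 ≤ p.2 + 3 * n - y₁ + n + 1 - j by omega)
  have h1 := (tileS_S (M := M) hn (j := j) (by omega) (by omega) hk).tilt
    (shape_home_S hn hS ha) (store_S hn hm)
  have h2 := (tileS_rest_E (M := M) hn (j := j) (by omega) (by omega)).tilt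
    (shape_middle_E hn hS hb) (store_SE hn hm)
  have h3 := (tileS_rest_S (M := M) hn (j := j) (by omega) (by omega)).tilt
    (shape_right_S hn hS hb) (store_SES hn hm)
  have h4 := (tileS_W (M := M) hn (j := j) (by omega) (by omega) hk').tilt
    (shape_lower_W hn hS hc) (store_SESW hn hm)
  have h5 := drop_tilt (k₁ := l) (q := (n - 1 - j, -n - 1 + j)) (shape_left_N (M := M) hn hS he)
    (store_SESWN hn hm) (e := .S) (by simp [Dir.vec]) hp ?_ (by omega) ?_ ?_
  · have h0 := reach_climbing (M := M) hn hS hm (3 * n + 1 + j) (by omega)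
    rw [climbing] at h0
    push_cast at h0
    exact (h0.trans (h1.reach.trans (h2.reach.trans (h3.reach.trans (h4.reach.trans
      (h5.reach.trans (reach_home_of_upper hn hS' hm))))))).mono (by omega)
  · ext <;> simp only [mv, Dir.vec, Prod.fst_add, Prod.snd_add] <;> omega
  · refine free_singleton hn fun t ht ht' => ?_
    simp only [mv, Dir.vec]
    rcases le_or_gt (-n - 1 + j + t * 1) (-1 : ℤ) with h | h
    · exact .laneS (by omega)
    · exact .left (by omega)
  · intro t ht
    simp only [mv, Dir.vec]; omega

theorem reach_drop_W (hn : 0 < n) (hS : Bounds n S x₀ x₁ y₀ y₁)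
    (hp : CanDrop S .W p)
    (hx : x₀ - 1 ≤ p.1 ∧ p.1 ≤ x₁) (hy : y₀ ≤ p.2 ∧ p.2 ≤ y₁) (hm : m ≤ M) :
    Reach (10 * n + 8) (home n M S x₁ y₁ (m + 1)) (home n M (insert p S) x₁ y₁ m) := by
  have hw := hS.width; have hh := hS.height
  -- The top of the shape lies on row `3 * n`, and the lane delivers to row `3 * n - j`.
  obtain ⟨j, hj⟩ := exists_natCast (show 0 ≤ y₁ - p.2 by omega)
  obtain ⟨a, ha⟩ := exists_natCast (show 0 ≤ 2 * n - 1 - y₁ + y₀ by omega)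
  obtain ⟨b, hb⟩ := exists_natCast (show 0 ≤ (n : ℤ) + 1 by omega)
  obtain ⟨c, hc⟩ := exists_natCast (show 0 ≤ 3 * n - x₁ + x₀ by omega)
  obtain ⟨e, he⟩ := exists_natCast (show 0 ≤ 3 * n - y₁ + y₀ by omega)
  obtain ⟨f, hf⟩ := exists_natCast (show 0 ≤ 2 * n - 1 - x₁ + x₀ by omega)
  obtain ⟨k, hk⟩ := exists_natCast (show 0 ≤ 11 * (n : ℤ) + 8 by omega)
  obtain ⟨k', hk'⟩ := exists_natCast (show 0 ≤ 8 * (n : ℤ) + 4 + 3 * j by omega)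
  obtain ⟨k'', hk''⟩ := exists_natCast (show 0 ≤ 5 * (n : ℤ) + 2 - 2 * j by omega)
  obtain ⟨l, hl⟩ := exists_natCast (show 0 ≤ p.1 + 2 * n - 1 - x₁ + 2 + j by omega)
  have h1 := (tileW_S (M := M) hn (j := j) (by omega) (by omega) hk).tilt
    (shape_home_S hn hS ha) (store_S hn hm)
  have h2 := (tileW_rest_E (M := M) hn (j := j) (by omega) (by omega)).tilt
    (shape_middle_E hn hS hb) (store_SE hn hm)
  have h3 := (tileW_rest_S (M := M) hn (j := j) (by omega) (by omega)).tilt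
    (shape_right_S hn hS hb) (store_SES hn hm)
  have h4 := (tileW_W (M := M) hn (j := j) (by omega) (by omega) hk').tilt
    (shape_lower_W hn hS hc) (store_SESW hn hm)
  have h5 := (tileW_WN (M := M) hn (j := j) (by omega) (by omega) hk'').tilt
    (shape_left_N hn hS he) (store_SESWN hn hm)
  have h6 := drop_tilt (k₁ := l) (q := (-2 - j, 3 * n - j)) (shape_upper_E (M := M) hn hS hf)
    (store_SESWNE hn hm) (e := .W) (by simp [Dir.vec]) hp ?_ (by omega) ?_ ?_
  · have h0 := reach_climbing (M := M) hn hS hm (4 * n + 1 + j) (by omega)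
    rw [climbing] at h0
    push_cast at h0
    exact (h0.trans (h1.reach.trans (h2.reach.trans (h3.reach.trans (h4.reach.trans
      (h5.reach.trans h6.reach)))))).mono (by omega)
  · ext <;> simp only [mv, Dir.vec, Prod.fst_add, Prod.snd_add] <;> omega
  · refine free_singleton hn fun t ht ht' => ?_
    simp only [mv, Dir.vec]
    rcases lt_trichotomy (-2 - j + t * 1) (-1 : ℤ) with h | h | h
    · exact .laneW (by omega)
    · exact .entryW (by omega)
    · exact .upper (by omega)
  · intro t ht
    simp only [mv, Dir.vec]; omega

theorem Bounds.insert (hS : Bounds n S x₀ x₁ y₀ y₁)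
    (hw : max x₁ p.1 - min x₀ p.1 ≤ n - 1) (hh : max y₁ p.2 - min y₀ p.2 ≤ n - 1) :
    Bounds n (insert p S) (min x₀ p.1) (max x₁ p.1) (min y₀ p.2) (max y₁ p.2) where
  mem := by
    rintro c (rfl | hc)
    · omega
    · have := hS.mem c hc
      omega
  left := by
    rcases le_total x₀ p.1 with h | h
    · obtain ⟨c, hc, e⟩ := hS.left
      exact ⟨c, Or.inr hc, by omega⟩
    · exact ⟨p, Or.inl rfl, by omega⟩
  right := by
    rcases le_total p.1 x₁ with h | h
    · obtain ⟨c, hc, e⟩ := hS.right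
      exact ⟨c, Or.inr hc, by omega⟩
    · exact ⟨p, Or.inl rfl, by omega⟩
  bottom := by
    rcases le_total y₀ p.2 with h | h
    · obtain ⟨c, hc, e⟩ := hS.bottom
      exact ⟨c, Or.inr hc, by omega⟩
    · exact ⟨p, Or.inl rfl, by omega⟩
  top := by
    rcases le_total p.2 y₁ with h | h
    · obtain ⟨c, hc, e⟩ := hS.top
      exact ⟨c, Or.inr hc, by omega⟩
    · exact ⟨p, Or.inl rfl, by omega⟩
  width := hw
  height := hh

theorem not_adjacent_of_far {a b : ℤ × ℤ}
    (h : a.1 + 2 ≤ b.1 ∨ b.1 + 2 ≤ a.1 ∨ a.2 + 2 ≤ b.2 ∨ b.2 + 2 ≤ a.2) : ¬ Adjacent a b :=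
  (Apart.of_far h).2

/-- A tile that is dropped outside the bounding box can be dropped on the side it lies on. -/
theorem CanDrop.exists_dir (hS : Bounds n S x₀ x₁ y₀ y₁) (hp : CanDrop S d p) :
    (∃ e, CanDrop S e p) ∧ (x₀ ≤ p.1 ∧ p.1 ≤ x₁ ∧ y₀ ≤ p.2 ∧ p.2 ≤ y₁) ∨
    CanDrop S .N p ∧ (x₀ ≤ p.1 ∧ p.1 ≤ x₁ ∧ p.2 = y₁ + 1) ∨
    CanDrop S .E p ∧ (p.1 = x₁ + 1 ∧ y₀ ≤ p.2 ∧ p.2 ≤ y₁) ∨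
    CanDrop S .S p ∧ (x₀ ≤ p.1 ∧ p.1 ≤ x₁ ∧ p.2 = y₀ - 1) ∨
    CanDrop S .W p ∧ (p.1 = x₀ - 1 ∧ y₀ ≤ p.2 ∧ p.2 ≤ y₁) := by
  have hfar : ∀ e : Dir, (∀ k : ℕ, 0 < k → ∀ c ∈ S,
      (p + k • e.vec).1 + 2 ≤ c.1 ∨ c.1 + 2 ≤ (p + k • e.vec).1 ∨
      (p + k • e.vec).2 + 2 ≤ c.2 ∨ c.2 + 2 ≤ (p + k • e.vec).2) → CanDrop S e p := by
    refine fun e he => ⟨hp.1, fun k hk => ⟨fun hc => ?_, fun c hc =>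
      not_adjacent_of_far (he k hk c hc)⟩⟩
    have := he k hk _ hc
    omega
  obtain ⟨q, hq, hadj⟩ := hp.1.2
  have hb := hS.mem q hq
  rw [Adjacent] at hadj
  have hpq : (p.1 = q.1 ∧ (p.2 = q.2 + 1 ∨ p.2 = q.2 - 1)) ∨
      (p.2 = q.2 ∧ (p.1 = q.1 + 1 ∨ p.1 = q.1 - 1)) := by
    rcases abs_cases (p.1 - q.1) with h1 | h1 <;> rcases abs_cases (p.2 - q.2) with h2 | h2 <;>
      omega
  -- Beyond a side of the box, every earlier point of the perpendicular half-line is at least two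
  -- units away from all of `S`.
  by_cases hN : p.2 = y₁ + 1
  · refine Or.inr (Or.inl ⟨hfar .N fun k hk c hc => ?_, by omega⟩)
    have := hS.mem c hc
    simp [Dir.vec]
    omega
  by_cases hE : p.1 = x₁ + 1
  · refine Or.inr (Or.inr (Or.inl ⟨hfar .E fun k hk c hc => ?_, by omega⟩))
    have := hS.mem c hc
    simp [Dir.vec]
    omega
  by_cases hS' : p.2 = y₀ - 1
  · refine Or.inr (Or.inr (Or.inr (Or.inl ⟨hfar .S fun k hk c hc => ?_, by omega⟩)))
    have := hS.mem c hc
    simp [Dir.vec]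
    omega
  by_cases hW : p.1 = x₀ - 1
  · refine Or.inr (Or.inr (Or.inr (Or.inr ⟨hfar .W fun k hk c hc => ?_, by omega⟩)))
    have := hS.mem c hc
    simp [Dir.vec]
    omega
  exact Or.inl ⟨⟨d, hp⟩, by omega⟩

theorem reach_insert (hn : 0 < n) (hS : Bounds n S x₀ x₁ y₀ y₁)
    (hp : CanDrop S d p) (hw : max x₁ p.1 - min x₀ p.1 ≤ n - 1)
    (hh : max y₁ p.2 - min y₀ p.2 ≤ n - 1) (hm : m ≤ M) :
    Reach (10 * n + 8) (home n M S x₁ y₁ (m + 1))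
      (home n M (insert p S) (max x₁ p.1) (max y₁ p.2) m) := by
  have hS' := hS.insert hw hh
  have dN : CanDrop S .N p → (x₀ ≤ p.1 ∧ p.1 ≤ x₁) → (y₀ ≤ p.2 ∧ p.2 ≤ y₁ + 1) →
      Reach (10 * n + 8) (home n M S x₁ y₁ (m + 1))
        (home n M (insert p S) (max x₁ p.1) (max y₁ p.2) m) := by
    intro h hx hy
    rw [max_eq_left hx.2, min_eq_left hy.1] at hS'
    rw [max_eq_left hx.2]
    exact reach_drop_N hn hS hS' h hx hy hm
  have dE : CanDrop S .E p → (x₀ ≤ p.1 ∧ p.1 ≤ x₁ + 1) → (y₀ ≤ p.2 ∧ p.2 ≤ y₁) →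
      Reach (10 * n + 8) (home n M S x₁ y₁ (m + 1))
        (home n M (insert p S) (max x₁ p.1) (max y₁ p.2) m) := by
    intro h hx hy
    rw [min_eq_left hx.1, min_eq_left hy.1] at hS'
    exact reach_drop_E hn hS hS' h hx hy hm
  have dS : CanDrop S .S p → (x₀ ≤ p.1 ∧ p.1 ≤ x₁) → (y₀ - 1 ≤ p.2 ∧ p.2 ≤ y₁) →
      Reach (10 * n + 8) (home n M S x₁ y₁ (m + 1))
        (home n M (insert p S) (max x₁ p.1) (max y₁ p.2) m) := by
    intro h hx hy
    rw [min_eq_left hx.1, max_eq_left hy.2] at hS'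
    rw [max_eq_left hy.2]
    exact reach_drop_S hn hS hS' h hx hy hm
  have dW : CanDrop S .W p → (x₀ - 1 ≤ p.1 ∧ p.1 ≤ x₁) → (y₀ ≤ p.2 ∧ p.2 ≤ y₁) →
      Reach (10 * n + 8) (home n M S x₁ y₁ (m + 1))
        (home n M (insert p S) (max x₁ p.1) (max y₁ p.2) m) := by
    intro h hx hy
    rw [max_eq_left hx.2, max_eq_left hy.2]
    exact reach_drop_W hn hS h hx hy hm
  have hle := hS.le
  rcases hp.exists_dir hS with ⟨⟨e, h⟩, hb⟩ | ⟨h, hb⟩ | ⟨h, hb⟩ | ⟨h, hb⟩ | ⟨h, hb⟩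
  -- Inside the bounding box the original direction can be kept, since every lane reaches all its
  -- rows or columns.
  · cases e
    · exact dN h (by omega) (by omega)
    · exact dE h (by omega) (by omega)
    · exact dS h (by omega) (by omega)
    · exact dW h (by omega) (by omega)
  · exact dN h (by omega) (by omega)
  · exact dE h (by omega) (by omega)
  · exact dS h (by omega) (by omega)
  · exact dW h (by omega) (by omega)

end word

/-! ### Universality -/

/-- `S` is in its home position and `m` tiles are in the reservoir. -/
def AtHome (n M : ℕ) (S : Set (ℤ × ℤ)) (m : ℕ) (C : Config (Fin 1)) : Prop :=
  ∃ x₀ x₁ y₀ y₁, Bounds n S x₀ x₁ y₀ y₁ ∧ C = home n M S x₁ y₁ m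

/-- The initial configuration: a seed and `M` tiles in the reservoir. -/
def initial (n M : ℕ) : Config (Fin 1) :=
  noTile (theBoard n M) (origin n M) {((2 * n - 1 : ℤ), (3 * n : ℤ))} (0, 5 * n + 5) M

/-- Tiles are conserved: seed and reservoir have `M + 1` tiles in all, so `m` is what remains after
building `u`. All intermediate shapes lie in the same box, which bounds their width and height by
`n`. -/
theorem exists_atHome (hn : 0 < n) {w : ℕ} (hw : w ≤ n) {u : Set (ℤ × ℤ)} (hu : IsDropShape u)
    (hb : u ⊆ box n w) (m : ℕ) (hm : m + u.ncard = M + 1) :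
    ∃ C, AtHome n M u m C ∧ Reach ((M - m) * (10 * n + 8)) (initial n M) C := by
  induction hu generalizing m with
  | seed p =>
    rw [Set.ncard_singleton] at hm
    obtain rfl : m = M := by omega
    refine ⟨_, ⟨p.1, p.1, p.2, p.2, ⟨by simp, by simp, by simp, by simp, by simp,
      by omega, by omega⟩, rfl⟩,
      ?_⟩
    have : home n m {p} p.1 p.2 m = initial n m := by
      rw [home, initial, place, Set.image_singleton]
      congr 2
      ext <;> simp
    rw [this]
    exact (Reach.refl _).mono (Nat.zero_le _)
  | drop S d p hS hp ih =>
    have hSb : S ⊆ box n w := (Set.subset_insert p S).trans hb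
    have hfin : S.Finite :=
      ((Set.finite_Icc 1 (n : ℤ)).prod (Set.finite_Icc 1 (w : ℤ))).subset hSb
    rw [Set.ncard_insert_of_notMem hp.1.1 hfin] at hm
    obtain ⟨C, ⟨x₀, x₁, y₀, y₁, hB, rfl⟩, hC⟩ := ih hSb (m + 1) (by omega)
    have hin : ∀ c ∈ insert p S, (1 ≤ c.1 ∧ c.1 ≤ n) ∧ 1 ≤ c.2 ∧ c.2 ≤ w := by
      intro c hc
      exact hb hc
    have hp' := hin p (Or.inl rfl)
    have hwid : max x₁ p.1 - min x₀ p.1 ≤ n - 1 := by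
      obtain ⟨c, hc, h1⟩ := hB.left
      obtain ⟨c', hc', h2⟩ := hB.right
      have := hin c (Or.inr hc)
      have := hin c' (Or.inr hc')
      omega
    have hhei : max y₁ p.2 - min y₀ p.2 ≤ n - 1 := by
      obtain ⟨c, hc, h1⟩ := hB.bottom
      obtain ⟨c', hc', h2⟩ := hB.top
      have := hin c (Or.inr hc)
      have := hin c' (Or.inr hc')
      omega
    refine ⟨_, ⟨_, _, _, _, hB.insert hwid hhei, rfl⟩, ?_⟩
    refine (hC.trans (reach_insert hn hB hp hwid hhei (by omega))).mono ?_
    have hpos : 0 < S.ncard := by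
      obtain ⟨c, hc, _⟩ := hB.left
      exact (Set.ncard_pos hfin).2 ⟨c, hc⟩
    obtain ⟨l, hl⟩ : ∃ l, M = m + 1 + l := ⟨M - (m + 1), by omega⟩
    rw [hl, show m + 1 + l - (m + 1) = l by omega, show m + 1 + l - m = l + 1 by omega]
    exact (Nat.succ_mul _ _).ge

theorem exists_atHome_zero (hn : 0 < n) {u : Set (ℤ × ℤ)} {m : ℕ} (hm : m ≤ M)
    {C : Config (Fin 1)} (hC : AtHome n M u m C) :
    ∃ C', AtHome n M u 0 C' ∧ Reach (m * (10 * n + 8)) C C' := by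
  induction m generalizing C with
  | zero => exact ⟨C, hC, by rw [Nat.zero_mul]; exact Reach.refl C⟩
  | succ m ih =>
    obtain ⟨x₀, x₁, y₀, y₁, hB, rfl⟩ := hC
    obtain ⟨C', h1, h2⟩ := ih (by omega) ⟨x₀, x₁, y₀, y₁, hB, rfl⟩
    refine ⟨C', h1, ((reach_discard hn hB (by omega)).trans h2).mono ?_⟩
    rw [Nat.add_mul m 1]; omega

/-- This idle tilt serves to make the tilt word nonempty, as the transitive closure in
`Reconfigurable` requires. -/
theorem AtHome.tilt (hn : 0 < n) {u : Set (ℤ × ℤ)} {C : Config (Fin 1)} (hC : AtHome n M u 0 C) :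
    Tilt selfAff .E C C := by
  obtain ⟨x₀, x₁, y₀, y₁, hB, rfl⟩ := hC
  have : StoreMove n M .E 0 0 (0, 5 * n + 5) (0, 5 * n + 5) 0 := by
    refine ⟨by simp [mv], fun j hj => absurd hj (by omega), fun t ht => ?_⟩
    simp only [mv, Dir.vec]
    omega
  exact (shape_home_E hn hB).tilt this

theorem AtHome.stronglyRepresents {u : Set (ℤ × ℤ)} {C : Config (Fin 1)}
    (hC : AtHome n M u 0 C) : StronglyRepresents C u := by
  obtain ⟨x₀, x₁, y₀, y₁, hB, rfl⟩ := hC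
  refine ⟨cellTile (origin n M) '' place u (2 * n - 1 - x₁, 3 * n - y₁), ?_,
    (2 * n - 1 - x₁, 3 * n - y₁) + origin n M, ?_⟩
  · have : {i : ℕ | i < 0 + 2 ∧ i ≠ 1} = {0} := by
      ext i
      simp only [Set.mem_ofPred_eq, Set.mem_singleton_iff]
      omega
    rw [home, noTile, this, conf, Set.image_singleton, Set.image_singleton]
    rfl
  · rw [place, Set.image_image, Set.image_image]
    refine Set.image_congr fun c _ => ?_
    simp only [cellTile, add_assoc]

theorem initial_isLegal (hn : 0 < n) : (initial n M).IsLegal selfAff := by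
  have hap : FamApart {i | i < M + 2 ∧ i ≠ 1}
      (pieces {((2 * n - 1 : ℤ), (3 * n : ℤ))} (0, 0) (0, 5 * n + 5)) := by
    apply famApart_noTile
    rintro _ rfl j hj
    apply Apart.of_far
    simp only [stored]
    omega
  have hmem : ∀ P ∈ (initial n M).polys, ∃ c : ℤ × ℤ, Open n M c.1 c.2 ∧
      P = {cellTile (origin n M) c} := by
    rintro _ ⟨_, ⟨_ | _ | i, ⟨hi, hi'⟩, rfl⟩, rfl⟩
    · exact ⟨(2 * n - 1, 3 * n), .upper (by simp only; omega), Set.image_singleton⟩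
    · exact absurd rfl hi'
    · refine ⟨stored (0, 5 * n + 5) i, ?_, Set.image_singleton⟩
      simp only [stored]
      -- The front tile already stands on the staircase; the others are inside the reservoir.
      rcases Nat.eq_zero_or_pos i with rfl | h
      · exact .climb (by omega)
      · exact .store (by omega)
  have hdis : ∀ P ∈ (initial n M).polys, ∀ Q ∈ (initial n M).polys, ∀ s ∈ P, ∀ t ∈ Q,
      (s.pos = t.pos ∨ Bonded selfAff s t) → P = Q := by
    rintro _ ⟨A, hA, rfl⟩ _ ⟨A', hA', rfl⟩ _ ⟨a, ha, rfl⟩ _ ⟨b, hb, rfl⟩ h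
    by_contra hne
    obtain ⟨h1, h2⟩ := hap.separated A hA A' hA' (fun e => hne (by rw [e])) a ha b hb
    rcases h with h | h
    · exact h1 (add_right_cancel h)
    · exact h2 ((bonded_cellTile _ a b).1 h)
  refine ⟨?_, ?_, ?_, fun P hP Q hQ s hs t ht h => hdis P hP Q hQ s hs t ht (Or.inl h),
    fun P hP Q hQ s hs t ht h => hdis P hP Q hQ s hs t ht (Or.inr h)⟩
  · exact (((Set.finite_lt_nat (M + 2)).subset fun i hi => hi.1).image _).image _
  · intro P hP
    obtain ⟨c, _, rfl⟩ := hmem P hP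
    exact ⟨Set.finite_singleton _, Set.singleton_nonempty _, Set.injOn_singleton _ _,
      by rintro s rfl t rfl; exact .refl⟩
  · intro P hP t ht
    obtain ⟨c, hc, rfl⟩ := hmem P hP
    obtain rfl := ht
    exact hc.free hn

end TiltAssembly

theorem mainTheorem3 :
    ∃ (k : ℕ) (G : Fin k → Fin k → Bool) (K : ℕ),
      ∀ h w : ℕ, 0 < w → w ≤ h →
        ∃ C : TiltAssembly.Config (Fin k),
          C.IsLegal G ∧
          C.board.size ≤ K * (h ^ 2 * w) ∧
          TiltAssembly.StronglyUniversal G C (TiltAssembly.dropShapes h w) ∧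
          ∀ u ∈ TiltAssembly.dropShapes h w,
            ∃ (ds : List TiltAssembly.Dir) (D : TiltAssembly.Config (Fin k)),
              ds.length ≤ K * (h ^ 2 * w) ∧
              TiltAssembly.TiltSeq G ds C D ∧
              TiltAssembly.StronglyRepresents D u := by
  open TiltAssembly in
  -- The constant is `24 * 24`: both sides of the board are estimated with `1 ≤ h ≤ h * w`, by `24 *
  -- (h * w)` and `24 * h`. It is ample for the number of tilts.
  refine ⟨1, selfAff, 576, fun h w hw hwh => ⟨initial h (h * w), ?_, ?_, ?_⟩⟩
  · exact initial_isLegal (by omega)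
  · change (4 * (h * w) + 11 * h + 9) * (12 * h + 12) ≤ 576 * (h ^ 2 * w)
    have h1 : h ≤ h * w := Nat.le_mul_of_pos_right h hw
    calc (4 * (h * w) + 11 * h + 9) * (12 * h + 12) ≤ (24 * (h * w)) * (24 * h) :=
          Nat.mul_le_mul (by omega) (by omega)
      _ = 576 * (h ^ 2 * w) := by ring
  · have key : ∀ u ∈ dropShapes h w, ∃ (ds : List Dir) (D : Config (Fin 1)), ds ≠ [] ∧
        ds.length ≤ 576 * (h ^ 2 * w) ∧ TiltSeq selfAff ds (initial h (h * w)) D ∧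
        StronglyRepresents D u := by
      rintro u ⟨hu, hb⟩
      have hn : 0 < h := by omega
      have hcard : u.ncard ≤ h * w := by
        have hbox : (box h w).ncard = h * w := by
          rw [box, Set.ncard_prod]
          simp [Set.ncard_eq_toFinset_card']
        rw [← hbox]
        exact Set.ncard_le_ncard hb ((Set.finite_Icc _ _).prod (Set.finite_Icc _ _))
      obtain ⟨C, hC, hR⟩ := exists_atHome (M := h * w) hn hwh hu hb (h * w + 1 - u.ncard)
        (by omega)
      have hpos : 0 < u.ncard := by
        rw [Set.ncard_pos (((Set.finite_Icc _ _).prod (Set.finite_Icc _ _)).subset hb)]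
        cases hu with
        | seed p => exact ⟨p, rfl⟩
        | drop S d p => exact ⟨p, Or.inl rfl⟩
      obtain ⟨D, hD, hR'⟩ := exists_atHome_zero hn (by omega) hC
      obtain ⟨ds, hl, hs⟩ := hR.trans hR'
      refine ⟨ds ++ [.E], D, by simp, ?_, hs.append ⟨D, hD.tilt hn, rfl⟩, hD.stronglyRepresents⟩
      -- Building and discarding together process each of the `h * w` stored tiles exactly once.
      rw [← Nat.add_mul, Nat.sub_add_cancel (by omega)] at hl
      have h1 : h ≤ h * w := Nat.le_mul_of_pos_right h hw
      rw [List.length_append, List.length_singleton]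
      calc ds.length + 1 ≤ h * w * (10 * h + 8) + h * w * 1 :=
            Nat.add_le_add hl (by omega)
        _ = h * w * (10 * h + 9) := by ring
        _ ≤ h * w * (576 * h) := Nat.mul_le_mul le_rfl (by omega)
        _ = 576 * (h ^ 2 * w) := by ring
    refine ⟨⟨{D | Reconfigurable selfAff (initial h (h * w)) D}, fun u hu => ?_,
      fun D hD => hD⟩, fun u hu => ?_⟩
    · obtain ⟨ds, D, h1, _, h3, h4⟩ := key u hu
      exact ⟨D, h3.reconfigurable h1, h4⟩
    · obtain ⟨ds, D, _, h2, h3, h4⟩ := key u hu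
      exact ⟨ds, D, h2, h3, h4⟩
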